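/- **Setting.** Let $G=(V,E)$ be a directed graph with source $s$, sink $t$ and continuous non-decreasing edge costs $l_e:\mathbb R_{\ge 0}\to\mathbb R_{\ge 0}$. For $q\ge 0$, a feasible flow for the demand rate $q$ is a vector $x\in\mathbb R_{\ge 0}^{E}$ whose inflow minus outflow is $q$ at $t$, $-q$ at $s$, and $0$ at all other vertices. The length of a path $P$ is $l_P(x)=\sum_{e\in P}l_e(x_e)$, and $P$ (or a cycle) is flow-carrying if $x_e>0$ on all its edges. A feasible flow $x$ is a Wardrop equilibrium if no directed cycle is flow-carrying and $l_P(x)\le l_Q(x)$ for all simple directed $s$-$t$-paths $P,Q$ with $P$ flow-carrying. Its support set is $S(x)=\{e\in E: x_e>0\}$. For an integer $j\ge 1$, the $j$-th nested Braess network $\mathcal B^{(j)}$ has vertices $s=v_0,v_1,\dots,v_{2j},v_{2j+1}=t$ and the following edges and costs: - $(v_i,v_{i+1})$ for $0\le i\le 2j$, $i\ne j$, with cost $l_e(x)=x$; - $(v_i,v_{2j-i})$ for $0\le i\le j-1$, with constant cost $10^{\,j-1-i}$; - $(v_{i+1},v_{2j+1-i})$ for $0\le i\le j-1$, with constant cost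 $10^{\,j-1-i}$; - $(v_j,v_{j+1})$, with constant cost $0$. **Lemma.** Let $j\ge 1$. 1. $\mathcal B^{(j)}$ has $2j+2$ vertices and $4j+1$ edges. 2. For every demand rate $q\ge 0$ there is exactly one Wardrop equilibrium $x(q)$ in $\mathcal B^{(j)}$. 3. There are $2^{j+1}$ different demand rates $q_1,\dots,q_{2^{j+1}}\in[0,3\cdot 10^{\,j-1})$ such that the support sets of the Wardrop equilibria for $q_1,\dots,q_{2^{j+1}}$ are pairwise different. 4. The function $q\mapsto x(q)$ is piecewise linear on $[0,\infty)$: there are breakpoints $0=\lambda_1<\dots<\lambda_K$ and vectors $M_i,N_i$ with $x(q)=qM_i+N_i$ for $q\in[\lambda_i,\lambda_{i+1}]$, where $\lambda_{K+1}=\infty$ and the last interval is $[\lambda_K,\infty)$. Every such representation has $K\ge 2^{j+1}-1$ parts. Hence the output of the parametric equilibrium computation can be exponential in the size of the network: there is a constant $c>1$ such that, for every $j\ge 1$, every such representation of the equilibrium function of $\mathcal B^{(j)}$ has at least $c^{\,|V|+|E|}$ parts. -/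

import Mathlib

/-- A directed single-commodity network on the vertex set `V`, without parallel edges. -/
structure DirectedNetwork (V : Type) where
  edges : Finset (V × V)
  cost : V × V → ℝ → ℝ
  source : V
  target : V

namespace DirectedNetwork

variable {V : Type}

/-- Simple directed path from the source to the target, given by its list of vertices. -/
def IsPath (N : DirectedNetwork V) (p : List V) : Prop :=
  p.head? = some N.source ∧ p.getLast? = some N.target ∧ p.Nodup ∧
    p.IsChain (fun u v => (u, v) ∈ N.edges)

/-- Simple directed cycle, given by its list of vertices in which the first vertex is
repeated at the end. -/
def IsCycle (N : DirectedNetwork V) (c : List V) : Prop :=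
  2 ≤ c.length ∧ c.head? = c.getLast? ∧ c.tail.Nodup ∧
    c.IsChain (fun u v => (u, v) ∈ N.edges)

/-- The list of edges traversed by a list of vertices. -/
def stepsOf (p : List V) : List (V × V) := p.zip p.tail

/-- All edges of the path or cycle `p` have positive flow. -/
def FlowCarrying (x : V × V → ℝ) (p : List V) : Prop :=
  ∀ e ∈ stepsOf p, 0 < x e

/-- The length of a path with respect to the flow `x`. -/
def pathCost (N : DirectedNetwork V) (x : V × V → ℝ) (p : List V) : ℝ :=
  ((stepsOf p).map (fun e => N.cost e (x e))).sum

/-- Feasible directed flow for the demand rate `q`. A vector in `ℝ^E` is represented by a function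
on all pairs of vertices that vanishes outside the edge set. The excess (inflow minus outflow) is
`q` at the target, `-q` at the source and `0` at all other vertices. -/
structure IsFeasible [DecidableEq V] (N : DirectedNetwork V) (q : ℝ) (x : V × V → ℝ) : Prop where
  eq_zero : ∀ e, e ∉ N.edges → x e = 0
  nonneg : ∀ e ∈ N.edges, 0 ≤ x e
  excess : ∀ v, (∑ e ∈ N.edges with e.2 = v, x e) - (∑ e ∈ N.edges with e.1 = v, x e) =
    (if v = N.target then q else 0) - (if v = N.source then q else 0)

/-- Wardrop equilibrium for the demand rate `q`. -/
structure IsWardropEquilibrium [DecidableEq V] (N : DirectedNetwork V) (q : ℝ)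
    (x : V × V → ℝ) : Prop where
  feasible : N.IsFeasible q x
  no_cycle : ∀ c, N.IsCycle c → ¬ FlowCarrying x c
  path_le : ∀ P Q, N.IsPath P → N.IsPath Q → FlowCarrying x P → N.pathCost x P ≤ N.pathCost x Q

/-- The support set of a flow: the edges with positive flow. -/
def flowSupport (N : DirectedNetwork V) (x : V × V → ℝ) : Set (V × V) :=
  {e | e ∈ N.edges ∧ 0 < x e}

/-- `f` is a solution of the parametrized equilibrium problem: `f q` is a Wardrop equilibrium
for every demand rate `q ≥ 0`. -/
def IsEquilibriumFunction [DecidableEq V] (N : DirectedNetwork V)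
    (f : ℝ → V × V → ℝ) : Prop :=
  ∀ q, 0 ≤ q → N.IsWardropEquilibrium q (f q)

end DirectedNetwork

/-- `B` is the set of breakpoints `0 = λ₁ < λ₂ < ⋯ < λ_K` of a piecewise linear representation of
`f` on `[0, ∞)`: between consecutive breakpoints, and beyond the last one, `f q = q M + N` for some
vectors `M` and `N`. The number of function parts of the representation is `K = B.card`. -/
structure IsBreakpointSet {ι : Type} (f : ℝ → ι → ℝ) (B : Finset ℝ) : Prop where
  zero_mem : 0 ∈ B
  nonneg : ∀ b ∈ B, 0 ≤ b
  affine : ∀ a b, 0 ≤ a → a ≤ b → (∀ t ∈ B, t ∉ Set.Ioo a b) →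
    ∃ M N : ι → ℝ, ∀ q ∈ Set.Icc a b, f q = q • M + N

namespace NestedBraess

/-- The vertices `s = v_0, v_1, …, v_{2j+1} = t`. -/
abbrev Vertex (j : ℕ) : Type := Fin (2 * j + 2)

/-- The edges `(v_i, v_{i+1})` with `0 ≤ i ≤ 2j` and `i ≠ j`. -/
def E₁ (j : ℕ) : Finset (Vertex j × Vertex j) :=
  {e | (e.2 : ℕ) = (e.1 : ℕ) + 1 ∧ (e.1 : ℕ) ≠ j}

/-- The edges `(v_i, v_{2j-i})` with `0 ≤ i ≤ j - 1`. -/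
def E₂ (j : ℕ) : Finset (Vertex j × Vertex j) :=
  {e | (e.1 : ℕ) < j ∧ (e.1 : ℕ) + (e.2 : ℕ) = 2 * j}

/-- The edges `(v_{i+1}, v_{2j+1-i})` with `0 ≤ i ≤ j - 1`. -/
def E₃ (j : ℕ) : Finset (Vertex j × Vertex j) :=
  {e | 1 ≤ (e.1 : ℕ) ∧ (e.1 : ℕ) ≤ j ∧ (e.1 : ℕ) + (e.2 : ℕ) = 2 * j + 2}

/-- The middle edge `(v_j, v_{j+1})`. -/
def middle (j : ℕ) : Finset (Vertex j × Vertex j) :=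
  {e | (e.1 : ℕ) = j ∧ (e.2 : ℕ) = j + 1}

def slope (j : ℕ) (e : Vertex j × Vertex j) : ℝ := if e ∈ E₁ j then 1 else 0

/-- The constant `10^(j-1-i)` on both `(v_i, v_{2j-i})` and `(v_{i+1}, v_{2j+1-i})`, for
`0 ≤ i ≤ j - 1`, and `0` on all other edges. -/
def offset (j : ℕ) (e : Vertex j × Vertex j) : ℝ :=
  if e ∈ E₂ j then 10 ^ (j - 1 - (e.1 : ℕ))
  else if e ∈ E₃ j then 10 ^ (j - 1 - ((e.1 : ℕ) - 1))
  else 0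

end NestedBraess

open NestedBraess in
/-- The `j`-th nested Braess network. -/
noncomputable def nestedBraess (j : ℕ) : DirectedNetwork (NestedBraess.Vertex j) where
  edges := E₁ j ∪ E₂ j ∪ E₃ j ∪ middle j
  cost e x := slope j e * x + offset j e
  source := 0
  target := Fin.last (2 * j + 1)

/-!
A flow is an equilibrium iff some node potential grows along every edge by at most the cost of the
edge, and by exactly this cost along edges with positive flow. Pairing two equilibria with their
potentials and summing by parts shows that the length of the flow-carrying paths is a monotone
function of the demand rate, and that two equilibria for the same rate agree on all edges of
strictly increasing cost. In `𝓑^(j)` the edges of constant cost form a Hamiltonian path, which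
carries no nonzero circulation, so the equilibrium is unique.

The network `𝓑^(j+1)` arises from `𝓑^(j)` by adding a source and a target. An equilibrium of
`𝓑^(j)` for the rate `q` with path length `l` extends to `𝓑^(j+1)` with `z` further units on each of
the two bypasses iff `q + z + l ≤ 10 ^ j`, with equality if `z > 0`. For small rates one may thus
take `z = 0`, which leaves the rate `q` unchanged, or `z = 10 ^ j - q - l`, which maps the rates
antitonically into `[0, 2 * 10 ^ j]`. So every support occurs in `𝓑^(j+1)` both without and with the
bypasses, and the support in which the inner network is empty occurs as well, for rates above
`2 * 10 ^ j`.

Equilibria with a common support are closed under convex combinations, so the equilibrium function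
is affine wherever the support is constant. Conversely, nonnegative affine functions have constant
support in the interior of an interval, so every part of a piecewise linear representation accounts
for at most one support that occurs for infinitely many rates.
-/

theorem extend_single {ι κ M : Type*} [DecidableEq ι] [DecidableEq κ] [Zero M] {f : ι → κ}
    (hf : Function.Injective f) (i : ι) (c : M) :
    Function.extend f (Pi.single i c) 0 = Pi.single (f i) c := by
  ext k
  by_cases hk : k ∈ Set.range f
  · obtain ⟨k, rfl⟩ := hk
    simp [hf.extend_apply, Pi.single_apply, hf.eq_iff]
  · rw [Function.extend_apply' _ _ _ hk, Pi.single_eq_of_ne (fun h => hk ⟨i, h.symm⟩),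
      Pi.zero_apply]

namespace DirectedNetwork

variable {V : Type}

section NetInflow

variable [Fintype V]

/-- Inflow minus outflow at each vertex, as a linear map on all edge vectors. -/
def netInflow : (V × V → ℝ) →ₗ[ℝ] V → ℝ where
  toFun x v := ∑ u, x (u, v) - ∑ u, x (v, u)
  map_add' x y := by
    ext v
    simp only [Pi.add_apply, Finset.sum_add_distrib]
    ring
  map_smul' c x := by
    ext v
    simp only [Pi.smul_apply, smul_eq_mul, RingHom.id_apply, ← Finset.mul_sum, mul_sub]

theorem netInflow_apply (x : V × V → ℝ) (v : V) :
    netInflow x v = ∑ u, x (u, v) - ∑ u, x (v, u) := rfl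

theorem netInflow_single [DecidableEq V] (u v : V) (c : ℝ) :
    netInflow (Pi.single (u, v) c) = Pi.single v c - Pi.single u c := by
  ext w
  simp only [netInflow_apply, Pi.sub_apply, Pi.single_apply, Prod.mk.injEq, ite_and]
  by_cases hw : w = u <;> simp [hw]

theorem netInflow_extend {W : Type} [Fintype W] {f : V → W} (hf : Function.Injective f)
    (x : V × V → ℝ) :
    netInflow (Function.extend (Prod.map f f) x 0) = Function.extend f (netInflow x) 0 := by
  have hff : Function.Injective (Prod.map f f) := hf.prodMap hf
  ext w
  by_cases hw : ∃ v, f v = w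
  · obtain ⟨v, rfl⟩ := hw
    rw [hf.extend_apply, netInflow_apply, netInflow_apply,
      ← Fintype.sum_of_injective f hf (fun u => x (u, v)),
      ← Fintype.sum_of_injective f hf (fun u => x (v, u))]
    · intro u hu
      refine Function.extend_apply' _ _ _ ?_
      rintro ⟨e, he⟩
      exact hu ⟨e.2, congrArg Prod.snd he⟩
    · intro u
      exact (hff.extend_apply x 0 (v, u)).symm
    · intro u hu
      refine Function.extend_apply' _ _ _ ?_
      rintro ⟨e, he⟩
      exact hu ⟨e.1, congrArg Prod.fst he⟩
    · intro u
      exact (hff.extend_apply x 0 (u, v)).symm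
  · have hin : ∀ u, Function.extend (Prod.map f f) x 0 (u, w) = 0 := fun u =>
      Function.extend_apply' _ _ _ fun ⟨e, he⟩ => hw ⟨e.2, congrArg Prod.snd he⟩
    have hout : ∀ u, Function.extend (Prod.map f f) x 0 (w, u) = 0 := fun u =>
      Function.extend_apply' _ _ _ fun ⟨e, he⟩ => hw ⟨e.1, congrArg Prod.fst he⟩
    simp [netInflow_apply, hin, hout, Function.extend_apply' _ _ _ hw]

theorem sum_potential_sub_mul (π : V → ℝ) (x : V × V → ℝ) :
    ∑ e, (π e.2 - π e.1) * x e = ∑ v, π v * netInflow x v := by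
  simp only [netInflow_apply, sub_mul, mul_sub, Finset.sum_sub_distrib, Finset.mul_sum]
  rw [Fintype.sum_prod_type_right, Fintype.sum_prod_type]

/-- A circulation cannot cross a cut through a single edge. -/
theorem apply_eq_zero_of_netInflow_eq_zero {d : V × V → ℝ} (hd : netInflow d = 0) {π : V → ℝ}
    {e₀ : V × V} (h₀ : π e₀.1 ≠ π e₀.2) (h : ∀ e, e ≠ e₀ → d e ≠ 0 → π e.1 = π e.2) :
    d e₀ = 0 := by
  have hsum := sum_potential_sub_mul π d
  rw [Fintype.sum_eq_single e₀] at hsum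
  · simpa [hd, sub_eq_zero, h₀.symm] using hsum
  · intro e he
    by_cases hde : d e = 0
    · simp [hde]
    · simp [h e he hde]

end NetInflow

section Feasible

variable [DecidableEq V] {N : DirectedNetwork V} {q r : ℝ} {x y : V × V → ℝ}

theorem IsFeasible.nonneg' (hx : N.IsFeasible q x) (e : V × V) : 0 ≤ x e := by
  by_cases he : e ∈ N.edges
  · exact hx.nonneg e he
  · exact (hx.eq_zero e he).ge

theorem IsFeasible.mem_edges (hx : N.IsFeasible q x) {e : V × V} (he : x e ≠ 0) :
    e ∈ N.edges :=
  not_imp_comm.1 (hx.eq_zero e) he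

theorem IsFeasible.flowSupport_eq (hx : N.IsFeasible q x) :
    N.flowSupport x = Function.support x := by
  ext e
  exact ⟨fun he => he.2.ne', fun he => ⟨hx.mem_edges he, (hx.nonneg' e).lt_of_ne' he⟩⟩

section Fintype

variable [Fintype V]

theorem netInflow_apply_eq_sum_filter (hx : ∀ e, e ∉ N.edges → x e = 0) (v : V) :
    netInflow x v = ∑ e ∈ N.edges with e.2 = v, x e - ∑ e ∈ N.edges with e.1 = v, x e := by
  have extend_sum (p : V × V → Prop) [DecidablePred p] :
      ∑ e ∈ N.edges with p e, x e = ∑ e, if p e then x e else 0 := by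
    rw [Finset.sum_filter]
    refine Finset.sum_subset (Finset.subset_univ _) fun e _ he => ?_
    simp [hx e he]
  rw [extend_sum, extend_sum, Fintype.sum_prod_type, Fintype.sum_prod_type_right]
  simp [netInflow_apply]

theorem isFeasible_iff : N.IsFeasible q x ↔ (∀ e, e ∉ N.edges → x e = 0) ∧ (∀ e, 0 ≤ x e) ∧
    netInflow x = Pi.single N.target q - Pi.single N.source q := by
  refine ⟨fun h => ⟨h.eq_zero, h.nonneg', ?_⟩, fun ⟨hz, hn, hb⟩ => ⟨hz, fun e _ => hn e, ?_⟩⟩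
  · ext v
    simp [netInflow_apply_eq_sum_filter h.eq_zero, h.excess, Pi.single_apply]
  · intro v
    simp [← netInflow_apply_eq_sum_filter hz, hb, Pi.single_apply]

theorem IsFeasible.netInflow_eq (hx : N.IsFeasible q x) :
    netInflow x = Pi.single N.target q - Pi.single N.source q :=
  (isFeasible_iff.1 hx).2.2

theorem IsFeasible.sum_potential_sub_mul (hx : N.IsFeasible q x) (π : V → ℝ) :
    ∑ e, (π e.2 - π e.1) * x e = q * (π N.target - π N.source) := by
  rw [DirectedNetwork.sum_potential_sub_mul, hx.netInflow_eq]
  simp [mul_sub, Pi.single_apply, mul_comm]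

end Fintype

theorem isFeasible_zero [Finite V] : N.IsFeasible 0 0 := by
  have := Fintype.ofFinite V
  simp [isFeasible_iff]

theorem IsFeasible.add_smul [Finite V] (hx : N.IsFeasible q x) (hy : N.IsFeasible r y)
    {a b : ℝ} (ha : 0 ≤ a) (hb : 0 ≤ b) : N.IsFeasible (a * q + b * r) (a • x + b • y) := by
  have := Fintype.ofFinite V
  refine isFeasible_iff.2 ⟨fun e he => ?_, fun e => ?_, ?_⟩
  · simp [hx.eq_zero e he, hy.eq_zero e he]
  · exact add_nonneg (mul_nonneg ha (hx.nonneg' e)) (mul_nonneg hb (hy.nonneg' e))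
  · ext v
    simp only [map_add, map_smul, hx.netInflow_eq, hy.netInflow_eq, Pi.add_apply, Pi.smul_apply,
      Pi.sub_apply, Pi.single_apply, smul_eq_mul]
    split_ifs <;> ring

end Feasible

section Walks

/-- `N.IsWalk u p v`: there is a directed walk from `u` to `v` whose vertices after `u` are listed
in `p`. The starting vertex is left out so that walks are concatenated by appending lists. -/
inductive IsWalk (N : DirectedNetwork V) : V → List V → V → Prop
  | nil (u : V) : N.IsWalk u [] u
  | cons {u v w : V} {p : List V} (he : (u, v) ∈ N.edges) (hp : N.IsWalk v p w) :
      N.IsWalk u (v :: p) w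

variable {N : DirectedNetwork V} {x : V × V → ℝ} {u v w : V} {p r : List V}

theorem isWalk_iff : N.IsWalk u p v ↔
    (u :: p).getLast? = some v ∧ (u :: p).IsChain fun a b => (a, b) ∈ N.edges := by
  refine ⟨fun h => ?_, fun h => ?_⟩
  · induction h with
    | nil => simp
    | cons he _ ih => exact ⟨by simpa using ih.1, ih.2.cons_cons he⟩
  · induction p generalizing u with
    | nil =>
      obtain rfl : u = v := by simpa using h.1
      exact .nil u
    | cons a p ih => exact .cons h.2.rel (ih ⟨by simpa using h.1, h.2.tail⟩)

theorem IsWalk.append (hp : N.IsWalk u p v) (hr : N.IsWalk v r w) : N.IsWalk u (p ++ r) w := by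
  induction hp with
  | nil => exact hr
  | cons he _ ih => exact .cons he (ih hr)

theorem IsPath.exists_isWalk (hp : N.IsPath p) :
    ∃ r, p = N.source :: r ∧ N.IsWalk N.source r N.target := by
  obtain ⟨r, rfl⟩ := List.head?_eq_some_iff.1 hp.1
  exact ⟨r, rfl, isWalk_iff.2 ⟨hp.2.1, hp.2.2.2⟩⟩

theorem pathCost_singleton (N : DirectedNetwork V) (x : V × V → ℝ) (u : V) :
    N.pathCost x [u] = 0 := rfl

theorem pathCost_cons_cons (N : DirectedNetwork V) (x : V × V → ℝ) (u v : V) (p : List V) :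
    N.pathCost x (u :: v :: p) = N.cost (u, v) (x (u, v)) + N.pathCost x (v :: p) := by
  simp [pathCost, stepsOf]

theorem flowCarrying_singleton (x : V × V → ℝ) (u : V) : FlowCarrying x [u] := by
  simp [FlowCarrying, stepsOf]

theorem flowCarrying_cons_cons :
    FlowCarrying x (u :: v :: p) ↔ 0 < x (u, v) ∧ FlowCarrying x (v :: p) := by
  simp [FlowCarrying, stepsOf]

theorem IsWalk.pathCost_append (hp : N.IsWalk u p v) (r : List V) :
    N.pathCost x (u :: (p ++ r)) = N.pathCost x (u :: p) + N.pathCost x (v :: r) := by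
  induction hp with
  | nil => simp [pathCost_singleton]
  | cons _ _ ih => simp only [List.cons_append, pathCost_cons_cons, ih, add_assoc]

theorem IsWalk.flowCarrying_append (hp : N.IsWalk u p v) :
    FlowCarrying x (u :: (p ++ r)) ↔ FlowCarrying x (u :: p) ∧ FlowCarrying x (v :: r) := by
  induction hp with
  | nil => simp [flowCarrying_singleton]
  | cons _ _ ih => simp only [List.cons_append, flowCarrying_cons_cons, ih, and_assoc]

end Walks

section Potential

/-- A node potential `π` certifying that flow-carrying walks are shortest: along every edge `π`
increases by at most the cost of the edge, and by exactly this cost if the edge carries flow. -/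
structure IsPotential (N : DirectedNetwork V) (x : V × V → ℝ) (π : V → ℝ) : Prop where
  le : ∀ e ∈ N.edges, π e.2 ≤ π e.1 + N.cost e (x e)
  tight : ∀ e ∈ N.edges, 0 < x e → π e.1 + N.cost e (x e) = π e.2

variable {N : DirectedNetwork V} {x : V × V → ℝ} {π : V → ℝ} {u v : V} {p : List V}

theorem IsPotential.le_pathCost (hπ : N.IsPotential x π) (hp : N.IsWalk u p v) :
    π v - π u ≤ N.pathCost x (u :: p) := by
  induction hp with
  | nil => simp [pathCost_singleton]
  | cons he _ ih =>
    rw [pathCost_cons_cons]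
    linarith [hπ.le _ he]

theorem IsPotential.pathCost_eq (hπ : N.IsPotential x π) (hp : N.IsWalk u p v)
    (hpx : FlowCarrying x (u :: p)) : N.pathCost x (u :: p) = π v - π u := by
  induction hp with
  | nil => simp [pathCost_singleton]
  | cons he _ ih =>
    rw [flowCarrying_cons_cons] at hpx
    rw [pathCost_cons_cons, ih hpx.2]
    linarith [hπ.tight _ he hpx.1]

end Potential

section Increasing

/-- Every edge of the network goes from a smaller to a larger vertex; in particular the network is
acyclic. -/
def Increasing [Preorder V] (N : DirectedNetwork V) : Prop :=
  ∀ e ∈ N.edges, e.1 < e.2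

variable [Preorder V] {N : DirectedNetwork V} {q : ℝ} {x : V × V → ℝ} {u v : V} {p : List V}

theorem Increasing.pairwise_lt (hN : N.Increasing)
    (hp : p.IsChain fun a b => (a, b) ∈ N.edges) : p.Pairwise (· < ·) :=
  List.isChain_iff_pairwise.1 (hp.imp fun a b => hN (a, b))

theorem Increasing.nodup_of_isWalk (hN : N.Increasing) (hp : N.IsWalk u p v) : (u :: p).Nodup :=
  (hN.pairwise_lt (isWalk_iff.1 hp).2).imp ne_of_lt

theorem Increasing.isPath_of_isWalk (hN : N.Increasing) (hp : N.IsWalk N.source p N.target) :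
    N.IsPath (N.source :: p) :=
  ⟨rfl, (isWalk_iff.1 hp).1, hN.nodup_of_isWalk hp, (isWalk_iff.1 hp).2⟩

theorem Increasing.not_isCycle (hN : N.Increasing) : ¬ N.IsCycle p := by
  rintro ⟨hlength, hclosed, -, hchain⟩
  match p, hlength with
  | a :: b :: c, _ =>
    have mem_tail : a ∈ b :: c := List.mem_of_getLast? (by simpa using hclosed.symm)
    exact lt_irrefl a (List.rel_of_pairwise_cons (hN.pairwise_lt hchain) mem_tail)

theorem Increasing.exists_min_walk [Finite V] (hN : N.Increasing) (x : V × V → ℝ)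
    (h : ∃ p, N.IsWalk u p v) : ∃ p, N.IsWalk u p v ∧
      ∀ r, N.IsWalk u r v → N.pathCost x (u :: p) ≤ N.pathCost x (u :: r) := by
  have := Fintype.ofFinite V
  refine Set.exists_min_image {p | N.IsWalk u p v} (fun p => N.pathCost x (u :: p)) ?_ h
  exact (List.finite_length_le V (Fintype.card V)).subset fun p hp =>
    (hN.nodup_of_isWalk hp).of_cons.length_le_card

variable [DecidableEq V]

theorem IsPotential.isWardropEquilibrium (hN : N.Increasing) {π : V → ℝ} (hx : N.IsFeasible q x)
    (hπ : N.IsPotential x π) : N.IsWardropEquilibrium q x where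
  feasible := hx
  no_cycle _ hc := absurd hc hN.not_isCycle
  path_le P Q hP hQ hPx := by
    obtain ⟨p, rfl, hp⟩ := hP.exists_isWalk
    obtain ⟨r, rfl, hr⟩ := hQ.exists_isWalk
    exact (hπ.pathCost_eq hp hPx).trans_le (hπ.le_pathCost hr)

theorem IsFeasible.exists_walk_from_source [Finite V] (hN : N.Increasing) (hq : 0 ≤ q)
    (hx : N.IsFeasible q x) (huv : 0 < x (u, v)) :
    ∃ p, N.IsWalk N.source p u ∧ FlowCarrying x (N.source :: p) := by
  have := Fintype.ofFinite V
  induction u using WellFoundedLT.induction generalizing v with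
  | ind u ih =>
  by_cases hu : u = N.source
  · exact ⟨[], hu ▸ .nil u, flowCarrying_singleton x _⟩
  obtain ⟨w, -, hw⟩ : ∃ w ∈ Finset.univ, 0 < x (w, u) := by
    refine Finset.exists_lt_of_sum_lt (f := fun _ => 0) ?_
    have hout : x (u, v) ≤ ∑ w, x (u, w) :=
      Finset.single_le_sum (fun w _ => hx.nonneg' (u, w)) (Finset.mem_univ v)
    have hexcess : 0 ≤ netInflow x u := by
      rw [hx.netInflow_eq, Pi.sub_apply, Pi.single_eq_of_ne hu, sub_zero, Pi.single_apply]
      split_ifs <;> simp [hq]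
    rw [netInflow_apply] at hexcess
    simpa using (huv.trans_le hout).trans_le (sub_nonneg.1 hexcess)
  have hwu := hx.mem_edges hw.ne'
  obtain ⟨p, hp, hpx⟩ := ih w (hN _ hwu) hw
  exact ⟨p ++ [u], hp.append (.cons hwu (.nil u)), hp.flowCarrying_append.2
    ⟨hpx, flowCarrying_cons_cons.2 ⟨hw, flowCarrying_singleton x u⟩⟩⟩

theorem IsFeasible.exists_walk_to_target [Finite V] (hN : N.Increasing) (hq : 0 ≤ q)
    (hx : N.IsFeasible q x) (huv : 0 < x (u, v)) :
    ∃ p, N.IsWalk v p N.target ∧ FlowCarrying x (v :: p) := by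
  have := Fintype.ofFinite V
  induction v using WellFoundedGT.induction generalizing u with
  | ind v ih =>
  by_cases hv : v = N.target
  · exact ⟨[], hv ▸ .nil v, flowCarrying_singleton x v⟩
  obtain ⟨w, -, hw⟩ : ∃ w ∈ Finset.univ, 0 < x (v, w) := by
    refine Finset.exists_lt_of_sum_lt (f := fun _ => 0) ?_
    have hin : x (u, v) ≤ ∑ w, x (w, v) :=
      Finset.single_le_sum (fun w _ => hx.nonneg' (w, v)) (Finset.mem_univ u)
    have hexcess : netInflow x v ≤ 0 := by
      rw [hx.netInflow_eq, Pi.sub_apply, Pi.single_eq_of_ne hv, zero_sub, Pi.single_apply]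
      split_ifs <;> simp [hq]
    rw [netInflow_apply] at hexcess
    simpa using (huv.trans_le hin).trans_le (sub_nonpos.1 hexcess)
  have hvw := hx.mem_edges hw.ne'
  obtain ⟨p, hp, hpx⟩ := ih w (hN _ hvw) hw
  exact ⟨w :: p, .cons hvw hp, flowCarrying_cons_cons.2 ⟨hw, hpx⟩⟩

theorem IsWardropEquilibrium.exists_isPotential [Finite V] (hN : N.Increasing)
    (hwalk : ∀ v, ∃ p, N.IsWalk N.source p v) (hq : 0 ≤ q) (hx : N.IsWardropEquilibrium q x) :
    ∃ π, N.IsPotential x π := by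
  choose P hP hPmin using fun v => hN.exists_min_walk x (hwalk v)
  have edge_le : ∀ e ∈ N.edges, N.pathCost x (N.source :: P e.2) ≤
      N.pathCost x (N.source :: P e.1) + N.cost e (x e) := by
    intro e he
    have h := hPmin e.2 _ ((hP e.1).append (.cons he (.nil e.2)))
    rwa [(hP e.1).pathCost_append, pathCost_cons_cons, pathCost_singleton, add_zero] at h
  refine ⟨fun v => N.pathCost x (N.source :: P v), edge_le, fun e he hpos =>
    (edge_le e he).antisymm' ?_⟩
  obtain ⟨p, hp, hpx⟩ := hx.feasible.exists_walk_from_source hN hq hpos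
  obtain ⟨r, hr, hrx⟩ := hx.feasible.exists_walk_to_target hN hq hpos
  -- compare the flow-carrying path through `e` with the detour along a shortest walk to `e.2`
  have hdetour := hx.path_le _ _ (hN.isPath_of_isWalk (hp.append (.cons he hr)))
    (hN.isPath_of_isWalk ((hP e.2).append hr))
    (hp.flowCarrying_append.2 ⟨hpx, flowCarrying_cons_cons.2 ⟨hpos, hrx⟩⟩)
  rw [hp.pathCost_append, (hP e.2).pathCost_append, pathCost_cons_cons] at hdetour
  linarith [hPmin e.1 p hp]

end Increasing

section Equilibrium

variable [DecidableEq V] {N : DirectedNetwork V} {q r l m : ℝ} {x y : V × V → ℝ}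

/-- The flow `x` is an equilibrium for the demand rate `q` witnessed by a node potential with
difference `l` between target and source, so that `l` is the common length of the flow-carrying
paths. When `q = 0` there are no such paths and `l` need not be unique. -/
def IsEquilibriumOfLength (N : DirectedNetwork V) (q l : ℝ) (x : V × V → ℝ) : Prop :=
  N.IsFeasible q x ∧ ∃ π, N.IsPotential x π ∧ π N.target - π N.source = l

theorem IsEquilibriumOfLength.isWardropEquilibrium [Preorder V] (hN : N.Increasing)
    (hx : N.IsEquilibriumOfLength q l x) : N.IsWardropEquilibrium q x :=
  let ⟨hfeasible, _, hπ, _⟩ := hx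
  hπ.isWardropEquilibrium hN hfeasible

theorem IsWardropEquilibrium.exists_isEquilibriumOfLength [Preorder V] [Finite V]
    (hN : N.Increasing) (hwalk : ∀ v, ∃ p, N.IsWalk N.source p v) (hq : 0 ≤ q)
    (hx : N.IsWardropEquilibrium q x) : ∃ l, N.IsEquilibriumOfLength q l x :=
  let ⟨π, hπ⟩ := hx.exists_isPotential hN hwalk hq
  ⟨_, hx.feasible, π, hπ, rfl⟩

theorem IsPotential.cost_mul_sub_le {π : V → ℝ} (hπ : N.IsPotential x π) (hx : N.IsFeasible q x)
    (hy : N.IsFeasible r y) (e : V × V) :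
    N.cost e (x e) * (x e - y e) ≤ (π e.2 - π e.1) * (x e - y e) := by
  by_cases he : e ∈ N.edges
  · rcases (hx.nonneg' e).eq_or_lt with hxe | hxe
    · nlinarith [hπ.le e he, hy.nonneg' e]
    · rw [← hπ.tight e he hxe, add_sub_cancel_left]
  · simp [hx.eq_zero e he, hy.eq_zero e he]

theorem cost_sub_mul_sub_nonneg (hcost : ∀ e ∈ N.edges, MonotoneOn (N.cost e) (Set.Ici 0))
    (hx : N.IsFeasible q x) (hy : N.IsFeasible r y) (e : V × V) :
    0 ≤ (N.cost e (x e) - N.cost e (y e)) * (x e - y e) := by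
  by_cases he : e ∈ N.edges
  · rcases le_total (x e) (y e) with hxy | hxy
    · exact mul_nonneg_of_nonpos_of_nonpos
        (sub_nonpos.2 (hcost e he (hx.nonneg' e) (hy.nonneg' e) hxy)) (sub_nonpos.2 hxy)
    · exact mul_nonneg (sub_nonneg.2 (hcost e he (hy.nonneg' e) (hx.nonneg' e) hxy))
        (sub_nonneg.2 hxy)
  · simp [hx.eq_zero e he, hy.eq_zero e he]

theorem IsEquilibriumOfLength.sum_cost_sub_mul_sub_le [Fintype V]
    (hx : N.IsEquilibriumOfLength q l x) (hy : N.IsEquilibriumOfLength r m y) :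
    ∑ e, (N.cost e (x e) - N.cost e (y e)) * (x e - y e) ≤ (q - r) * (l - m) := by
  obtain ⟨hxf, π, hπ, rfl⟩ := hx
  obtain ⟨hyf, ρ, hρ, rfl⟩ := hy
  calc _ ≤ ∑ e, ((π e.2 - π e.1) * (x e - y e) + (ρ e.2 - ρ e.1) * (y e - x e)) :=
        Finset.sum_le_sum fun e _ => by
          linarith [hπ.cost_mul_sub_le hxf hyf e, hρ.cost_mul_sub_le hyf hxf e]
    _ = _ := by
        simp only [mul_sub, Finset.sum_add_distrib, Finset.sum_sub_distrib,
          hxf.sum_potential_sub_mul, hyf.sum_potential_sub_mul]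
        ring

theorem IsEquilibriumOfLength.sub_mul_sub_nonneg [Finite V]
    (hcost : ∀ e ∈ N.edges, MonotoneOn (N.cost e) (Set.Ici 0))
    (hx : N.IsEquilibriumOfLength q l x) (hy : N.IsEquilibriumOfLength r m y) :
    0 ≤ (q - r) * (l - m) := by
  have := Fintype.ofFinite V
  exact (Finset.sum_nonneg fun e _ => cost_sub_mul_sub_nonneg hcost hx.1 hy.1 e).trans
    (hx.sum_cost_sub_mul_sub_le hy)

theorem IsEquilibriumOfLength.length_le [Finite V]
    (hcost : ∀ e ∈ N.edges, MonotoneOn (N.cost e) (Set.Ici 0))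
    (hx : N.IsEquilibriumOfLength q l x) (hy : N.IsEquilibriumOfLength r m y) (hqr : q < r) :
    l ≤ m := by
  nlinarith [hx.sub_mul_sub_nonneg hcost hy]

theorem IsEquilibriumOfLength.apply_eq_of_strictMonoOn [Finite V]
    (hcost : ∀ e ∈ N.edges, MonotoneOn (N.cost e) (Set.Ici 0))
    (hx : N.IsEquilibriumOfLength q l x) (hy : N.IsEquilibriumOfLength q m y) {e : V × V}
    (he : StrictMonoOn (N.cost e) (Set.Ici 0)) : x e = y e := by
  have := Fintype.ofFinite V
  have nonneg := cost_sub_mul_sub_nonneg hcost hx.1 hy.1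
  have hsum := hx.sum_cost_sub_mul_sub_le hy
  rw [sub_self, zero_mul] at hsum
  have heq : (N.cost e (x e) - N.cost e (y e)) * (x e - y e) = 0 :=
    (Finset.sum_eq_zero_iff_of_nonneg fun e _ => nonneg e).1
      (hsum.antisymm (Finset.sum_nonneg fun e _ => nonneg e)) e (Finset.mem_univ e)
  rcases mul_eq_zero.1 heq with h | h
  · exact he.injOn (hx.1.nonneg' e) (hy.1.nonneg' e) (sub_eq_zero.1 h)
  · exact sub_eq_zero.1 h

end Equilibrium

section AffineCosts

/-- Every edge cost is an affine function of the flow on the edge. -/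
def HasAffineCosts (N : DirectedNetwork V) : Prop :=
  ∀ e ∈ N.edges, ∃ a b : ℝ, ∀ t, N.cost e t = a * t + b

variable {N : DirectedNetwork V} {q r : ℝ} {x y : V × V → ℝ} {a b : ℝ}

theorem flowCarrying_congr (h : Function.support x = Function.support y) (hx : ∀ e, 0 ≤ x e)
    (hy : ∀ e, 0 ≤ y e) (p : List V) : FlowCarrying x p ↔ FlowCarrying y p := by
  have (e : V × V) : 0 < x e ↔ 0 < y e := by
    rw [(hx e).lt_iff_ne', (hy e).lt_iff_ne', ← Function.mem_support, h, Function.mem_support]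
  simp only [FlowCarrying, this]

theorem support_add_smul (hx : ∀ e, 0 ≤ x e) (hy : ∀ e, 0 ≤ y e) (ha : 0 < a) (hb : 0 < b) :
    Function.support (a • x + b • y) = Function.support x ∪ Function.support y := by
  ext e
  have := add_eq_zero_iff_of_nonneg (mul_nonneg ha.le (hx e)) (mul_nonneg hb.le (hy e))
  simp [this, ha.ne', hb.ne', ← not_and_or]

theorem HasAffineCosts.pathCost_add_smul (hN : N.HasAffineCosts) (hab : a + b = 1)
    {p : List V} (hp : p.IsChain fun u v => (u, v) ∈ N.edges) :
    N.pathCost (a • x + b • y) p = a * N.pathCost x p + b * N.pathCost y p := by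
  induction p with
  | nil => simp [pathCost, stepsOf]
  | cons u p ih =>
    cases p with
    | nil => simp [pathCost_singleton]
    | cons v p =>
      obtain ⟨c, d, hcd⟩ := hN (u, v) hp.rel
      simp only [pathCost_cons_cons, ih hp.tail, hcd, Pi.add_apply, Pi.smul_apply, smul_eq_mul]
      linear_combination (-d) * hab

theorem HasAffineCosts.isWardropEquilibrium_add_smul [DecidableEq V] [Finite V]
    (hN : N.HasAffineCosts) (hx : N.IsWardropEquilibrium q x) (hy : N.IsWardropEquilibrium r y)
    (hsupport : Function.support x = Function.support y) (ha : 0 < a) (hb : 0 < b)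
    (hab : a + b = 1) : N.IsWardropEquilibrium (a * q + b * r) (a • x + b • y) := by
  have := Fintype.ofFinite V
  have hfeasible := hx.feasible.add_smul hy.feasible ha.le hb.le
  have hcarrying : ∀ p, FlowCarrying (a • x + b • y) p → FlowCarrying x p ∧ FlowCarrying y p := by
    have hsupp := support_add_smul hx.feasible.nonneg' hy.feasible.nonneg' ha hb
    intro p hp
    refine ⟨?_, ?_⟩
    · rwa [← flowCarrying_congr (by simp [hsupp, hsupport]) hfeasible.nonneg' hx.feasible.nonneg']
    · rwa [← flowCarrying_congr (by simp [hsupp, hsupport]) hfeasible.nonneg' hy.feasible.nonneg']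
  refine ⟨hfeasible, fun c hc hcf => hx.no_cycle c hc (hcarrying c hcf).1, fun P Q hP hQ hPf => ?_⟩
  rw [hN.pathCost_add_smul hab hP.2.2.2, hN.pathCost_add_smul hab hQ.2.2.2]
  obtain ⟨hPx, hPy⟩ := hcarrying P hPf
  gcongr
  · exact hx.path_le P Q hP hQ hPx
  · exact hy.path_le P Q hP hQ hPy

end AffineCosts

section Closed

variable {N : DirectedNetwork V}

theorem isOpen_flowCarrying (p : List V) : IsOpen {x : V × V → ℝ | FlowCarrying x p} := by
  simp only [FlowCarrying, Set.ofPred_forall]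
  exact (List.finite_toSet (stepsOf p)).isOpen_biInter fun e _ =>
    isOpen_lt continuous_const (continuous_apply e)

theorem continuous_pathCost (hN : ∀ e ∈ N.edges, Continuous (N.cost e)) {p : List V}
    (hp : p.IsChain fun u v => (u, v) ∈ N.edges) : Continuous fun x => N.pathCost x p := by
  induction p with
  | nil => simpa [pathCost, stepsOf] using continuous_const
  | cons u p ih =>
    cases p with
    | nil => simpa only [pathCost_singleton] using continuous_const
    | cons v p =>
      simp only [pathCost_cons_cons]
      exact ((hN _ hp.rel).comp (continuous_apply (u, v))).add (ih hp.tail)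

theorem isClosed_setOf_isFeasible [DecidableEq V] [Finite V] (N : DirectedNetwork V) :
    IsClosed {p : ℝ × (V × V → ℝ) | N.IsFeasible p.1 p.2} := by
  have := Fintype.ofFinite V
  have happly (e : V × V) : Continuous fun p : ℝ × (V × V → ℝ) => p.2 e := by fun_prop
  have hsingle (v : V) : Continuous fun p : ℝ × (V × V → ℝ) => Pi.single (M := fun _ => ℝ) v p.1 :=
    (continuous_single v).comp continuous_fst
  have hnetInflow : Continuous (netInflow (V := V)) := netInflow.continuous_of_finiteDimensional
  simp only [isFeasible_iff, Set.ofPred_and, Set.ofPred_forall]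
  exact ((isClosed_iInter fun e => isClosed_iInter fun _ => isClosed_eq (happly e)
    continuous_const).inter ((isClosed_iInter fun e => isClosed_le continuous_const
      (happly e)).inter (isClosed_eq (hnetInflow.comp continuous_snd)
        ((hsingle N.target).sub (hsingle N.source)))))

theorem isClosed_setOf_isWardropEquilibrium [DecidableEq V] [Finite V]
    (hN : ∀ e ∈ N.edges, Continuous (N.cost e)) :
    IsClosed {p : ℝ × (V × V → ℝ) | N.IsWardropEquilibrium p.1 p.2} := by
  have hno_cycle : IsClosed {p : ℝ × (V × V → ℝ) | ∀ c, N.IsCycle c → ¬ FlowCarrying p.2 c} := by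
    simp only [Set.ofPred_forall]
    exact isClosed_iInter fun c => isClosed_iInter fun _ =>
      ((isOpen_flowCarrying c).preimage continuous_snd).isClosed_compl
  have hpath_le : IsClosed {p : ℝ × (V × V → ℝ) | ∀ P Q, N.IsPath P → N.IsPath Q →
      FlowCarrying p.2 P → N.pathCost p.2 P ≤ N.pathCost p.2 Q} := by
    simp only [Set.ofPred_forall]
    exact isClosed_iInter fun P => isClosed_iInter fun Q => isClosed_iInter fun hP =>
      isClosed_iInter fun hQ => isClosed_imp ((isOpen_flowCarrying P).preimage continuous_snd)
        (isClosed_le ((continuous_pathCost hN hP.2.2.2).comp continuous_snd)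
          ((continuous_pathCost hN hQ.2.2.2).comp continuous_snd))
  convert (isClosed_setOf_isFeasible N).inter (hno_cycle.inter hpath_le) using 1
  ext p
  exact ⟨fun h => ⟨h.feasible, h.no_cycle, h.path_le⟩, fun h => ⟨h.1, h.2.1, h.2.2⟩⟩

end Closed

end DirectedNetwork

section ConvexCombinations

variable {E : Type*} [AddCommGroup E] [Module ℝ E] {f : ℝ → E}

theorem three_point_identity_of_map_convexComb {p q r : ℝ} (hpq : p < q) (hqr : q < r)
    (hf : ∀ a b : ℝ, 0 < a → 0 < b → a + b = 1 → f (a * p + b * r) = a • f p + b • f r) :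
    (r - q) • f p + (p - r) • f q + (q - p) • f r = 0 := by
  have hpr : 0 < r - p := by linarith
  have hq := hf ((r - q) / (r - p)) ((q - p) / (r - p)) (div_pos (by linarith) hpr)
    (div_pos (by linarith) hpr) (by field_simp; ring)
  rw [show (r - q) / (r - p) * p + (q - p) / (r - p) * r = q by field_simp; ring] at hq
  rw [hq]
  match_scalars <;> field_simp <;> ring

theorem exists_eq_smul_add_of_map_convexComb {s : Set ℝ}
    (hf : ∀ p ∈ s, ∀ r ∈ s, ∀ a b : ℝ, 0 < a → 0 < b → a + b = 1 →
      f (a * p + b * r) = a • f p + b • f r) :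
    ∃ M N : E, ∀ q ∈ s, f q = q • M + N := by
  rcases s.subsingleton_or_nontrivial with hs | ⟨p, hp, r, hr, hpr⟩
  · rcases hs.eq_empty_or_singleton with rfl | ⟨a, rfl⟩
    · simp
    · exact ⟨0, f a, by simp⟩
  wlog hlt : p < r generalizing p r
  · exact this r hr p hp hpr.symm ((not_lt.1 hlt).lt_of_ne hpr.symm)
  have hne : r - p ≠ 0 := (sub_pos.2 hlt).ne'
  refine ⟨(r - p)⁻¹ • (f r - f p), (r - p)⁻¹ • (r • f p - p • f r), fun q hq => ?_⟩
  have hidentity : (r - q) • f p + (p - r) • f q + (q - p) • f r = 0 := by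
    rcases lt_trichotomy q p with hqp | rfl | hqp
    · linear_combination (norm := module)
        -three_point_identity_of_map_convexComb hqp hlt (hf q hq r hr)
    · module
    rcases lt_trichotomy q r with hqr | rfl | hqr
    · exact three_point_identity_of_map_convexComb hqp hqr (hf p hp r hr)
    · module
    · linear_combination (norm := module)
        -three_point_identity_of_map_convexComb hlt hqr (hf p hp q hq)
  apply smul_right_injective E hne
  simp only [smul_add, smul_smul, mul_left_comm _ q, mul_inv_cancel₀ hne, one_smul, mul_one]
  linear_combination (norm := module) -hidentity

end ConvexCombinations

section OrdConnectedFibers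

theorem frontier_subset_of_ordConnected {s : Set ℝ} (hs : s.OrdConnected) :
    frontier s ⊆ {sInf s, sSup s} := by
  rintro x ⟨hclosure, hinterior⟩
  have hnonempty : s.Nonempty := closure_nonempty_iff.1 ⟨x, hclosure⟩
  by_contra hx
  rw [Set.mem_insert_iff, Set.mem_singleton_iff, not_or] at hx
  obtain ⟨y, hy, hyx⟩ : ∃ y ∈ s, y < x := by
    by_contra! hlower
    exact hx.1 ((isGLB_of_mem_closure hlower hclosure).csInf_eq hnonempty).symm
  obtain ⟨z, hz, hxz⟩ : ∃ z ∈ s, x < z := by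
    by_contra! hupper
    exact hx.2 ((isLUB_of_mem_closure hupper hclosure).csSup_eq hnonempty).symm
  exact hinterior (mem_interior_iff_mem_nhds.2
    (Filter.mem_of_superset (Icc_mem_nhds hyx hxz) (hs.out hy hz)))

theorem subset_of_isPreconnected_of_disjoint_frontier {X : Type*} [TopologicalSpace X]
    {s t : Set X} (hs : IsPreconnected s) (hst : (s ∩ t).Nonempty)
    (hfrontier : Disjoint s (frontier t)) : s ⊆ t := by
  have mem_interior {x : X} (hxs : x ∈ s) (hxt : x ∈ closure t) : x ∈ interior t :=
    not_not.1 fun hx => Set.disjoint_left.1 hfrontier hxs ⟨hxt, hx⟩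
  obtain ⟨x, hxs, hxt⟩ := hst
  exact (hs.subset_of_closure_inter_subset isOpen_interior
    ⟨x, hxs, mem_interior hxs (subset_closure hxt)⟩
    fun y hy => mem_interior hy.2 (closure_mono interior_subset hy.1)).trans interior_subset

theorem exists_finset_forall_eq_of_ordConnected_fibers {α : Type*} [Finite α] {g : ℝ → α}
    (hg : ∀ a, {q | 0 ≤ q ∧ g q = a}.OrdConnected) :
    ∃ B : Finset ℝ, 0 ∈ B ∧ (∀ b ∈ B, 0 ≤ b) ∧ ∀ a b, 0 ≤ a → (∀ t ∈ B, t ∉ Set.Ioo a b) →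
      ∀ p ∈ Set.Ioo a b, ∀ r ∈ Set.Ioo a b, g p = g r := by
  have hfinite : (insert 0 (⋃ a, frontier {q | 0 ≤ q ∧ g q = a}) ∩ Set.Ici 0).Finite :=
    ((Set.finite_iUnion fun a => (Set.toFinite _).subset
      (frontier_subset_of_ordConnected (hg a))).insert 0).inter_of_left _
  refine ⟨hfinite.toFinset, by simp, fun b hb => (hfinite.mem_toFinset.1 hb).2,
    fun a b ha hB p hp r hr => ?_⟩
  refine (subset_of_isPreconnected_of_disjoint_frontier (t := {q | 0 ≤ q ∧ g q = g r})
    isPreconnected_Ioo ⟨r, hr, ha.trans hr.1.le, rfl⟩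
    (Set.disjoint_left.2 fun t ht hfrontier => ?_) hp).2
  exact hB t (hfinite.mem_toFinset.2
    ⟨Or.inr (Set.mem_iUnion.2 ⟨g r, hfrontier⟩), ha.trans ht.1.le⟩) ht

end OrdConnectedFibers

section BreakpointSets

theorem eq_zero_of_affine_of_nonneg {a b M N p r : ℝ} (ha : 0 ≤ a * M + N) (hb : 0 ≤ b * M + N)
    (hp : p ∈ Set.Ioo a b) (h : p * M + N = 0) : r * M + N = 0 := by
  have hM : M = 0 := by
    refine le_antisymm ?_ ?_
    · nlinarith [hp.1]
    · nlinarith [hp.2]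
  simpa [hM] using h

namespace IsBreakpointSet

variable {ι : Type} {f : ℝ → ι → ℝ} {B : Finset ℝ}

theorem support_eq (hB : IsBreakpointSet f B) (hf : ∀ q, 0 ≤ q → ∀ i, 0 ≤ f q i) {a b p r : ℝ}
    (ha : 0 ≤ a) (hab : ∀ t ∈ B, t ∉ Set.Ioo a b) (hp : p ∈ Set.Ioo a b) (hr : r ∈ Set.Ioo a b) :
    Function.support (f p) = Function.support (f r) := by
  have hle : a ≤ b := (hp.1.trans hp.2).le
  obtain ⟨M, N, hMN⟩ := hB.affine a b ha hle hab
  have hnonneg : ∀ t ∈ Set.Icc a b, ∀ i, 0 ≤ t * M i + N i := fun t ht i => by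
    simpa [hMN t ht] using hf t (ha.trans ht.1) i
  ext i
  refine not_congr ?_
  simp only [hMN p (Set.Ioo_subset_Icc_self hp), hMN r (Set.Ioo_subset_Icc_self hr), Pi.add_apply,
    Pi.smul_apply, smul_eq_mul]
  have hai := hnonneg a (Set.left_mem_Icc.2 hle) i
  have hbi := hnonneg b (Set.right_mem_Icc.2 hle) i
  exact ⟨eq_zero_of_affine_of_nonneg hai hbi hp, eq_zero_of_affine_of_nonneg hai hbi hr⟩

theorem exists_support_eq (hB : IsBreakpointSet f B) (hf : ∀ q, 0 ≤ q → ∀ i, 0 ≤ f q i) {b : ℝ}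
    (hb : b ∈ B) :
    ∃ S, ∀ q, b < q → (∀ t ∈ B, t ∉ Set.Ioc b q) → Function.support (f q) = S := by
  by_cases h : ∃ p, b < p ∧ ∀ t ∈ B, t ∉ Set.Ioc b p
  · obtain ⟨p, hbp, hp⟩ := h
    refine ⟨Function.support (f p), fun q hbq hq => ?_⟩
    have hmax : max p q ∉ B := fun hm => by
      rcases max_choice p q with hpq | hpq <;> rw [hpq] at hm
      exacts [hp p hm ⟨hbp, le_rfl⟩, hq q hm ⟨hbq, le_rfl⟩]
    obtain ⟨c, hc, hcB⟩ := exists_Ico_subset_of_mem_nhds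
      (B.finite_toSet.isClosed.isOpen_compl.mem_nhds hmax) ⟨max p q + 1, lt_add_one _⟩
    refine hB.support_eq hf (hB.nonneg b hb) (fun t ht htc => ?_)
      ⟨hbq, (le_max_right p q).trans_lt hc⟩ ⟨hbp, (le_max_left p q).trans_lt hc⟩
    rcases lt_or_ge t (max p q) with htm | htm
    · rcases lt_max_iff.1 htm with htp | htq
      exacts [hp t ht ⟨htc.1, htp.le⟩, hq t ht ⟨htc.1, htq.le⟩]
    · exact hcB ⟨htm, htc.2⟩ ht
  · exact ⟨∅, fun q hbq hq => absurd ⟨q, hbq, hq⟩ h⟩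

theorem ncard_infinite_supports_le (hB : IsBreakpointSet f B)
    (hf : ∀ q, 0 ≤ q → ∀ i, 0 ≤ f q i) :
    {S | {q | 0 ≤ q ∧ Function.support (f q) = S}.Infinite}.ncard ≤ B.card := by
  choose! S hS using fun b => hB.exists_support_eq hf (b := b)
  rw [← Set.ncard_coe_finset]
  refine (Set.ncard_le_ncard ?_ (B.finite_toSet.image S)).trans
    (Set.ncard_image_le B.finite_toSet)
  intro T hT
  obtain ⟨q, ⟨hq0, rfl⟩, hqB⟩ := (hT.sdiff B.finite_toSet).nonempty
  have hlt {t : ℝ} (ht : t ∈ B) (htq : t ≤ q) : t < q :=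
    htq.lt_of_ne fun h => hqB (h ▸ ht)
  obtain ⟨b, hb, hmax⟩ := Finset.exists_max_image (B.filter (· < q)) id
    ⟨0, Finset.mem_filter.2 ⟨hB.zero_mem, hlt hB.zero_mem hq0⟩⟩
  rw [Finset.mem_filter] at hb
  exact ⟨b, hb.1, (hS b hb.1 q hb.2 fun t ht htq =>
    (hmax t (Finset.mem_filter.2 ⟨ht, hlt ht htq.2⟩)).not_gt htq.1).symm⟩

end IsBreakpointSet

theorem DirectedNetwork.exists_isBreakpointSet {V : Type} [DecidableEq V] [Finite V]
    {N : DirectedNetwork V} (hN : N.HasAffineCosts)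
    (hunique : ∀ q x y, 0 ≤ q → N.IsWardropEquilibrium q x → N.IsWardropEquilibrium q y → x = y)
    {f : ℝ → V × V → ℝ} (hf : N.IsEquilibriumFunction f) : ∃ B, IsBreakpointSet f B := by
  have map_convexComb {p r a b : ℝ} (hp : 0 ≤ p) (hr : 0 ≤ r)
      (hpr : Function.support (f p) = Function.support (f r)) (ha : 0 < a) (hb : 0 < b)
      (hab : a + b = 1) : f (a * p + b * r) = a • f p + b • f r :=
    hunique _ _ _ (by positivity) (hf _ (by positivity))
      (hN.isWardropEquilibrium_add_smul (hf p hp) (hf r hr) hpr ha hb hab)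
  have hfibers (S : Set (V × V)) : {q | 0 ≤ q ∧ Function.support (f q) = S}.OrdConnected := by
    refine (convex_iff_forall_pos.2 fun p hp r hr a b ha hb hab => ?_).ordConnected (𝕜 := ℝ)
    obtain ⟨⟨hp, rfl⟩, hr, hrp⟩ := hp, hr
    refine ⟨by simp only [smul_eq_mul]; positivity, ?_⟩
    rw [smul_eq_mul, smul_eq_mul, map_convexComb hp hr hrp.symm ha hb hab,
      support_add_smul (hf p hp).feasible.nonneg' (hf r hr).feasible.nonneg' ha hb, hrp,
      Set.union_self]
  obtain ⟨B, h0, hnonneg, hB⟩ := exists_finset_forall_eq_of_ordConnected_fibers hfibers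
  refine ⟨B, h0, hnonneg, fun a b ha hab hdisjoint => ?_⟩
  rcases hab.eq_or_lt with rfl | hlt
  · exact ⟨0, f a, by simp⟩
  obtain ⟨M, L, hML⟩ := exists_eq_smul_add_of_map_convexComb (f := f) (s := Set.Ioo a b)
    fun p hp r hr _ _ => map_convexComb (ha.trans hp.1.le) (ha.trans hr.1.le)
      (hB a b ha hdisjoint p hp r hr)
  have hcontinuous : ∀ e ∈ N.edges, Continuous (N.cost e) := fun e he => by
    obtain ⟨c, d, hcd⟩ := hN e he
    simpa only [funext hcd] using (by fun_prop : Continuous fun t => c * t + d)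
  -- the formula extends to the end points because the equilibrium conditions are closed
  have hclosed : IsClosed {q : ℝ | N.IsWardropEquilibrium q (q • M + L)} :=
    (isClosed_setOf_isWardropEquilibrium hcontinuous).preimage
      (by fun_prop : Continuous fun q : ℝ => (q, q • M + L))
  refine ⟨M, L, fun q hq => hunique q _ _ (ha.trans hq.1) (hf q (ha.trans hq.1)) ?_⟩
  refine closure_minimal (fun t ht => ?_) hclosed ((closure_Ioo hlt.ne).ge hq)
  simpa only [Set.mem_ofPred_eq, ← hML t ht] using hf t (ha.trans ht.1.le)

end BreakpointSets

namespace NestedBraess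

open DirectedNetwork

variable {j : ℕ}

section Edges

theorem mem_E₁ {e : Vertex j × Vertex j} :
    e ∈ E₁ j ↔ (e.2 : ℕ) = (e.1 : ℕ) + 1 ∧ (e.1 : ℕ) ≠ j := by
  simp [E₁]

theorem mem_E₂ {e : Vertex j × Vertex j} :
    e ∈ E₂ j ↔ (e.1 : ℕ) < j ∧ (e.1 : ℕ) + (e.2 : ℕ) = 2 * j := by
  simp [E₂]

theorem mem_E₃ {e : Vertex j × Vertex j} :
    e ∈ E₃ j ↔ 1 ≤ (e.1 : ℕ) ∧ (e.1 : ℕ) ≤ j ∧ (e.1 : ℕ) + (e.2 : ℕ) = 2 * j + 2 := by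
  simp [E₃]

theorem mem_edges {e : Vertex j × Vertex j} : e ∈ (nestedBraess j).edges ↔
    (e.2 : ℕ) = (e.1 : ℕ) + 1 ∨ ((e.1 : ℕ) < j ∧ (e.1 : ℕ) + (e.2 : ℕ) = 2 * j) ∨
      (1 ≤ (e.1 : ℕ) ∧ (e.1 : ℕ) ≤ j ∧ (e.1 : ℕ) + (e.2 : ℕ) = 2 * j + 2) := by
  simp only [nestedBraess, middle, Finset.mem_union, mem_E₁, mem_E₂, mem_E₃, Finset.mem_filter,
    Finset.mem_univ, true_and]
  omega

@[simp] theorem source_nestedBraess : (nestedBraess j).source = 0 := rfl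

@[simp] theorem target_nestedBraess : (nestedBraess j).target = Fin.last (2 * j + 1) := rfl

theorem increasing_nestedBraess (j : ℕ) : (nestedBraess j).Increasing := by
  intro e he
  rw [mem_edges] at he
  rw [Fin.lt_def]
  omega

theorem exists_walk_from_source (v : Vertex j) : ∃ p, (nestedBraess j).IsWalk 0 p v := by
  induction v using Fin.induction with
  | zero => exact ⟨[], .nil 0⟩
  | succ i ih =>
    obtain ⟨p, hp⟩ := ih
    exact ⟨p ++ [i.succ], hp.append (.cons (mem_edges.2 (by simp)) (.nil i.succ))⟩

theorem cost_nestedBraess (e : Vertex j × Vertex j) (t : ℝ) :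
    (nestedBraess j).cost e t = slope j e * t + offset j e := rfl

theorem slope_nonneg (e : Vertex j × Vertex j) : 0 ≤ slope j e := by
  unfold slope
  split_ifs <;> simp

theorem hasAffineCosts_nestedBraess (j : ℕ) : (nestedBraess j).HasAffineCosts :=
  fun e _ => ⟨slope j e, offset j e, cost_nestedBraess e⟩

theorem monotoneOn_cost (e : Vertex j × Vertex j) :
    MonotoneOn ((nestedBraess j).cost e) (Set.Ici 0) := by
  intro s _ t _ hst
  simp only [cost_nestedBraess]
  gcongr
  exact slope_nonneg e

theorem strictMonoOn_cost {e : Vertex j × Vertex j} (he : slope j e ≠ 0) :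
    StrictMonoOn ((nestedBraess j).cost e) (Set.Ici 0) := by
  intro s _ t _ hst
  simp only [cost_nestedBraess]
  gcongr
  exact (slope_nonneg e).lt_of_ne' he

end Edges

section Uniqueness

/-- The position of a vertex on the Hamiltonian path formed by the edges of constant cost,
which starts `v_0, v_{2j}, v_2, v_{2j-2}, …` and, in reverse, `v_{2j+1}, v_1, v_{2j-1}, v_3, …`. -/
def pathPosition (v : Vertex j) : ℕ :=
  if (v : ℕ) % 2 = 0 ↔ (v : ℕ) ≤ j then v else 2 * j + 1 - v

theorem pathPosition_injective : Function.Injective (pathPosition (j := j)) := by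
  intro u v huv
  unfold pathPosition at huv
  ext
  have := u.isLt
  have := v.isLt
  split_ifs at huv <;> omega

theorem pathPosition_adjacent {e : Vertex j × Vertex j} (he : e ∈ (nestedBraess j).edges)
    (hslope : slope j e = 0) :
    pathPosition e.2 = pathPosition e.1 + 1 ∨ pathPosition e.1 = pathPosition e.2 + 1 := by
  have hE₁ : e ∉ E₁ j := by simpa [slope] using hslope
  rw [mem_edges] at he
  rw [mem_E₁] at hE₁
  unfold pathPosition
  have := e.1.isLt
  have := e.2.isLt
  split_ifs <;> omega

theorem circulation_eq_zero {d : Vertex j × Vertex j → ℝ} (hd : netInflow d = 0)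
    (hconst : ∀ e, d e ≠ 0 → e ∈ (nestedBraess j).edges ∧ slope j e = 0) : d = 0 := by
  ext e₀
  by_contra he₀
  obtain ⟨hmem₀, hslope₀⟩ := hconst e₀ he₀
  have hadj₀ := pathPosition_adjacent hmem₀ hslope₀
  have hlt₀ := increasing_nestedBraess j e₀ hmem₀
  -- removing `e₀` cuts the path of constant-cost edges into two parts
  refine he₀ (apply_eq_zero_of_netInflow_eq_zero hd (π := fun v =>
    if pathPosition v ≤ min (pathPosition e₀.1) (pathPosition e₀.2) then 1 else 0) ?_ ?_)
  · split_ifs <;> first | omega | norm_num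
  · intro e hne hde
    obtain ⟨hmem, hslope⟩ := hconst e hde
    have hadj := pathPosition_adjacent hmem hslope
    have hlt := increasing_nestedBraess j e hmem
    have hparallel : ¬ (pathPosition e.1 = pathPosition e₀.1 ∧
        pathPosition e.2 = pathPosition e₀.2) := fun h =>
      hne (Prod.ext (pathPosition_injective h.1) (pathPosition_injective h.2))
    have hantiparallel : ¬ (pathPosition e.1 = pathPosition e₀.2 ∧
        pathPosition e.2 = pathPosition e₀.1) := by
      rintro ⟨h₁, h₂⟩
      rw [pathPosition_injective h₁, pathPosition_injective h₂] at hlt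
      exact hlt.not_gt hlt₀
    split_ifs <;> first | rfl | (exfalso; omega)

theorem isWardropEquilibrium_unique {q : ℝ} {x y : Vertex j × Vertex j → ℝ} (hq : 0 ≤ q)
    (hx : (nestedBraess j).IsWardropEquilibrium q x)
    (hy : (nestedBraess j).IsWardropEquilibrium q y) : x = y := by
  obtain ⟨l, hxl⟩ :=
    hx.exists_isEquilibriumOfLength (increasing_nestedBraess j) exists_walk_from_source hq
  obtain ⟨m, hym⟩ :=
    hy.exists_isEquilibriumOfLength (increasing_nestedBraess j) exists_walk_from_source hq
  refine sub_eq_zero.1 (circulation_eq_zero ?_ fun e he => ⟨?_, ?_⟩)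
  · rw [map_sub, hx.feasible.netInflow_eq, hy.feasible.netInflow_eq, sub_self]
  · by_contra hmem
    simp [hx.feasible.eq_zero e hmem, hy.feasible.eq_zero e hmem] at he
  · by_contra hslope
    exact he (sub_eq_zero.2 (hxl.apply_eq_of_strictMonoOn (fun e _ => monotoneOn_cost e) hym
      (strictMonoOn_cost hslope)))

end Uniqueness

section Nesting

/-- The embedding of `𝓑^(j)` into `𝓑^(j+1)` on vertices, `v_i ↦ v_{i+1}`. -/
def shift : Vertex j ↪ Vertex (j + 1) where
  toFun v := v.castSucc.succ
  inj' := (Fin.succ_injective _).comp (Fin.castSucc_injective _)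

/-- The embedding of `𝓑^(j)` into `𝓑^(j+1)` on edges. -/
def shiftEdge : Vertex j × Vertex j ↪ Vertex (j + 1) × Vertex (j + 1) :=
  shift.prodMap shift

@[simp] theorem val_shift (v : Vertex j) : (shift v : ℕ) = v + 1 := rfl

@[simp] theorem shiftEdge_apply (e : Vertex j × Vertex j) :
    shiftEdge e = (shift e.1, shift e.2) := rfl

@[simp] theorem shift_ne_zero (v : Vertex j) : shift v ≠ 0 :=
  fun h => Nat.succ_ne_zero _ (congrArg Fin.val h)

@[simp] theorem shift_ne_last (v : Vertex j) : shift v ≠ Fin.last (2 * (j + 1) + 1) := by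
  simp only [ne_eq, Fin.ext_iff, val_shift, Fin.val_last]
  omega

/-- The four edges of `𝓑^(j+1)` that leave its source or enter its target. -/
def outerEdges (j : ℕ) : Finset (Vertex (j + 1) × Vertex (j + 1)) :=
  {(0, shift 0), (0, shift (Fin.last _)), (shift 0, Fin.last _),
    (shift (Fin.last _), Fin.last _)}

theorem eq_zero_or_eq_last_or_exists_shift (w : Vertex (j + 1)) :
    w = 0 ∨ w = Fin.last _ ∨ ∃ v, shift v = w := by
  induction w using Fin.cases with
  | zero => exact .inl rfl
  | succ w =>
    induction w using Fin.lastCases with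
    | last => exact .inr (.inl rfl)
    | cast v => exact .inr (.inr ⟨v, rfl⟩)

theorem edges_succ (j : ℕ) : (nestedBraess (j + 1)).edges =
    (nestedBraess j).edges.map shiftEdge ∪ outerEdges j := by
  ext ⟨u, v⟩
  rcases eq_zero_or_eq_last_or_exists_shift u with rfl | rfl | ⟨u, rfl⟩ <;>
  rcases eq_zero_or_eq_last_or_exists_shift v with rfl | rfl | ⟨v, rfl⟩ <;>
  simp only [Finset.mem_union, Finset.mem_map, Prod.exists, shiftEdge_apply, Prod.mk.injEq,
    shift.injective.eq_iff, shift_ne_zero, shift_ne_last, false_and, and_false, exists_false,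
    false_or, exists_eq_right_right, exists_eq_right] <;>
  simp only [mem_edges, outerEdges, Finset.mem_insert, Finset.mem_singleton, Prod.mk.injEq,
    Fin.ext_iff, val_shift, Fin.val_last, Fin.val_zero] <;>
  grind

theorem forall_mem_edges_succ {P : Vertex (j + 1) × Vertex (j + 1) → Prop} :
    (∀ e ∈ (nestedBraess (j + 1)).edges, P e) ↔
      (∀ e ∈ (nestedBraess j).edges, P (shiftEdge e)) ∧ P (0, shift 0) ∧
        P (0, shift (Fin.last _)) ∧ P (shift 0, Fin.last _) ∧
          P (shift (Fin.last _), Fin.last _) := by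
  simp only [edges_succ, outerEdges, Finset.forall_mem_union, Finset.forall_mem_map,
    Finset.forall_mem_insert, Finset.mem_singleton, forall_eq]

theorem edges_zero : (nestedBraess 0).edges = {(0, 1)} := by
  ext ⟨u, v⟩
  fin_cases u <;> fin_cases v <;> simp [mem_edges]

theorem card_edges (j : ℕ) : (nestedBraess j).edges.card = 4 * j + 1 := by
  induction j with
  | zero => rw [edges_zero]; rfl
  | succ j ih =>
    have hdisjoint : Disjoint ((nestedBraess j).edges.map shiftEdge) (outerEdges j) := by
      simp only [Finset.disjoint_right, outerEdges, Finset.forall_mem_insert,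
        Finset.mem_singleton, forall_eq]
      simp
    have houter : (outerEdges j).card = 4 := by
      simp [outerEdges, Fin.ext_iff]
    rw [edges_succ, Finset.card_union_of_disjoint hdisjoint, Finset.card_map, ih, houter]
    ring

theorem cost_shiftEdge (e : Vertex j × Vertex j) :
    (nestedBraess (j + 1)).cost (shiftEdge e) = (nestedBraess j).cost e := by
  have hE₁ : shiftEdge e ∈ E₁ (j + 1) ↔ e ∈ E₁ j := by simp [mem_E₁]
  have hE₂ : shiftEdge e ∈ E₂ (j + 1) ↔ e ∈ E₂ j := by
    simp only [mem_E₂, shiftEdge_apply, val_shift]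
    omega
  have hE₃ : shiftEdge e ∈ E₃ (j + 1) ↔ e ∈ E₃ j := by
    simp only [mem_E₃, shiftEdge_apply, val_shift]
    omega
  ext t
  simp only [cost_nestedBraess, slope, offset, hE₁, hE₂, hE₃]
  congr 1
  split_ifs with h₂ h₃
  · congr 1
    simp only [shiftEdge_apply, val_shift]
    omega
  · congr 1
    rw [mem_E₃] at h₃
    simp only [shiftEdge_apply, val_shift]
    omega
  · rfl

theorem cost_zero_shift_zero (t : ℝ) : (nestedBraess (j + 1)).cost (0, shift 0) t = t := by
  have h₂ : (0, shift 0) ∉ E₂ (j + 1) := by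
    simp only [mem_E₂, val_shift, Fin.val_zero]
    omega
  simp [cost_nestedBraess, slope, offset, mem_E₁, mem_E₃, h₂]

theorem cost_shift_last_last (t : ℝ) :
    (nestedBraess (j + 1)).cost (shift (Fin.last _), Fin.last _) t = t := by
  have h₁ : (shift (Fin.last (2 * j + 1)), Fin.last _) ∈ E₁ (j + 1) := by
    simp only [mem_E₁, val_shift, Fin.val_last]
    omega
  have h₂ : (shift (Fin.last (2 * j + 1)), Fin.last _) ∉ E₂ (j + 1) := by
    simp only [mem_E₂, val_shift, Fin.val_last]
    omega
  have h₃ : (shift (Fin.last (2 * j + 1)), Fin.last _) ∉ E₃ (j + 1) := by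
    simp only [mem_E₃, val_shift, Fin.val_last]
    omega
  simp [cost_nestedBraess, slope, offset, h₁, h₂, h₃]

theorem cost_zero_shift_last (t : ℝ) :
    (nestedBraess (j + 1)).cost (0, shift (Fin.last _)) t = 10 ^ j := by
  have h₂ : (0, shift (Fin.last (2 * j + 1))) ∈ E₂ (j + 1) := by
    simp only [mem_E₂, val_shift, Fin.val_last, Fin.val_zero]
    omega
  simp [cost_nestedBraess, slope, offset, mem_E₁, h₂]

theorem cost_shift_zero_last (t : ℝ) :
    (nestedBraess (j + 1)).cost (shift 0, Fin.last _) t = 10 ^ j := by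
  have h₁ : (shift 0, Fin.last _) ∉ E₁ (j + 1) := by
    simp only [mem_E₁, val_shift, Fin.val_last, Fin.val_zero]
    omega
  have h₂ : (shift 0, Fin.last _) ∉ E₂ (j + 1) := by
    simp only [mem_E₂, val_shift, Fin.val_last, Fin.val_zero]
    omega
  have h₃ : (shift 0, Fin.last _) ∈ E₃ (j + 1) := by
    simp only [mem_E₃, val_shift, Fin.val_last, Fin.val_zero]
    omega
  simp [cost_nestedBraess, slope, offset, h₁, h₂, h₃]

end Nesting

section Surround

variable {q l y z : ℝ} {x : Vertex j × Vertex j → ℝ}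

/-- The flow on `𝓑^(j+1)` that routes `z` units along each of the paths `v_0, v_1, t` and
`v_0, v_{2j+2}, t`, and follows `x` inside `𝓑^(j)` after sending `y` units, meant to be the demand
rate of `x`, from the new source to the old one and from the old target to the new one. -/
noncomputable def surround (y z : ℝ) (x : Vertex j × Vertex j → ℝ) :
    Vertex (j + 1) × Vertex (j + 1) → ℝ :=
  Function.extend shiftEdge x 0 + Pi.single (0, shift 0) (y + z) +
    Pi.single (0, shift (Fin.last _)) z + Pi.single (shift 0, Fin.last _) z +
    Pi.single (shift (Fin.last _), Fin.last _) (y + z)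

theorem surround_shiftEdge (y z : ℝ) (x : Vertex j × Vertex j → ℝ)
    (e : Vertex j × Vertex j) : surround y z x (shiftEdge e) = x e := by
  simp only [surround, Pi.add_apply, shiftEdge.injective.extend_apply]
  simp

@[simp] theorem surround_zero_shift_zero (y z : ℝ) (x : Vertex j × Vertex j → ℝ) :
    surround y z x (0, shift 0) = y + z := by
  simp [surround]

@[simp] theorem surround_zero_shift_last (y z : ℝ) (x : Vertex j × Vertex j → ℝ) :
    surround y z x (0, shift (Fin.last _)) = z := by
  simp [surround]

@[simp] theorem surround_shift_zero_last (y z : ℝ) (x : Vertex j × Vertex j → ℝ) :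
    surround y z x (shift 0, Fin.last _) = z := by
  simp [surround]

@[simp] theorem surround_shift_last_last (y z : ℝ) (x : Vertex j × Vertex j → ℝ) :
    surround y z x (shift (Fin.last _), Fin.last _) = y + z := by
  simp [surround]

theorem surround_of_notMem (hx : ∀ e, e ∉ (nestedBraess j).edges → x e = 0) (y z : ℝ)
    {e : Vertex (j + 1) × Vertex (j + 1)} (he : e ∉ (nestedBraess (j + 1)).edges) :
    surround y z x e = 0 := by
  rw [edges_succ, Finset.mem_union, not_or] at he
  obtain ⟨hinner, houter⟩ := he
  simp only [outerEdges, Finset.mem_insert, Finset.mem_singleton, not_or] at houter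
  by_cases hrange : e ∈ Set.range shiftEdge
  · obtain ⟨e, rfl⟩ := hrange
    rw [surround_shiftEdge, hx e (by simpa using hinner)]
  · simp [surround, Function.extend_apply' _ _ _ hrange, houter]

theorem netInflow_surround (y z : ℝ) (hx : netInflow x = Pi.single (Fin.last _) y - Pi.single 0 y) :
    netInflow (surround y z x) =
      Pi.single (Fin.last _) (y + 2 * z) - Pi.single 0 (y + 2 * z) := by
  have hinner : netInflow (Function.extend shiftEdge x 0) =
      Pi.single (shift (Fin.last _)) y - Pi.single (shift 0) y := by
    refine (netInflow_extend shift.injective x).trans ?_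
    rw [hx, ← extend_single shift.injective, ← extend_single shift.injective,
      ← Function.extend_sub, sub_self]
  simp only [surround, two_mul z, map_add, hinner, netInflow_single, Pi.single_add]
  abel

theorem exists_isPotential_surround {π : Vertex j → ℝ} (hπ : (nestedBraess j).IsPotential x π)
    (hl : π (Fin.last _) - π 0 = l) (hle : y + z + l ≤ 10 ^ j)
    (heq : 0 < z → y + z + l = 10 ^ j) :
    ∃ ρ, (nestedBraess (j + 1)).IsPotential (surround y z x) ρ ∧
      ρ (Fin.last _) - ρ 0 = 2 * (y + z) + l := by
  obtain ⟨ρ, hshift, hsource, htarget⟩ : ∃ ρ : Vertex (j + 1) → ℝ,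
      (∀ v, ρ (shift v) = y + z + (π v - π 0)) ∧ ρ 0 = 0 ∧ ρ (Fin.last _) = 2 * (y + z) + l :=
    ⟨Function.extend shift (fun v => y + z + (π v - π 0))
        (Pi.single (Fin.last _) (2 * (y + z) + l)),
      shift.injective.extend_apply _ _,
      (Function.extend_apply' _ _ _ fun ⟨_, h⟩ => shift_ne_zero _ h).trans (by simp),
      (Function.extend_apply' _ _ _ fun ⟨_, h⟩ => shift_ne_last _ h).trans (by simp)⟩
  have h : ∀ e ∈ (nestedBraess (j + 1)).edges,
      ρ e.2 ≤ ρ e.1 + (nestedBraess (j + 1)).cost e (surround y z x e) ∧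
        (0 < surround y z x e →
          ρ e.1 + (nestedBraess (j + 1)).cost e (surround y z x e) = ρ e.2) := by
    refine forall_mem_edges_succ.2 ⟨fun e he => ?_, ?_, ?_, ?_, ?_⟩
    · rw [cost_shiftEdge, surround_shiftEdge, shiftEdge_apply, hshift, hshift]
      exact ⟨by linarith [hπ.le e he], fun hpos => by linarith [hπ.tight e he hpos]⟩
    · rw [cost_zero_shift_zero, surround_zero_shift_zero, hsource, hshift]
      exact ⟨by linarith, fun _ => by linarith⟩
    · rw [cost_zero_shift_last, surround_zero_shift_last, hsource, hshift]
      exact ⟨by linarith, fun hpos => by linarith [heq hpos]⟩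
    · rw [cost_shift_zero_last, surround_shift_zero_last, htarget, hshift]
      exact ⟨by linarith, fun hpos => by linarith [heq hpos]⟩
    · rw [cost_shift_last_last, surround_shift_last_last, htarget, hshift]
      exact ⟨by linarith, fun _ => by linarith⟩
  exact ⟨ρ, ⟨fun e he => (h e he).1, fun e he => (h e he).2⟩, by rw [hsource, htarget, sub_zero]⟩

theorem isFeasible_surround (hx : (nestedBraess j).IsFeasible q x) (hq : 0 ≤ q) (hz : 0 ≤ z) :
    (nestedBraess (j + 1)).IsFeasible (q + 2 * z) (surround q z x) := by
  have hzero e (he : e ∉ (nestedBraess (j + 1)).edges) : surround q z x e = 0 :=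
    surround_of_notMem hx.eq_zero q z he
  have hnonneg : ∀ e ∈ (nestedBraess (j + 1)).edges, 0 ≤ surround q z x e :=
    forall_mem_edges_succ.2
      ⟨fun e _ => (hx.nonneg' e).trans_eq (surround_shiftEdge q z x e).symm,
        by simpa using add_nonneg hq hz, by simpa using hz, by simpa using hz,
        by simpa using add_nonneg hq hz⟩
  refine isFeasible_iff.2 ⟨hzero, fun e => ?_, netInflow_surround q z hx.netInflow_eq⟩
  by_cases he : e ∈ (nestedBraess (j + 1)).edges
  · exact hnonneg e he
  · exact (hzero e he).ge

theorem isEquilibriumOfLength_surround (hx : (nestedBraess j).IsEquilibriumOfLength q l x)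
    (hq : 0 ≤ q) (hz : 0 ≤ z) (hle : q + z + l ≤ 10 ^ j) (heq : 0 < z → q + z + l = 10 ^ j) :
    (nestedBraess (j + 1)).IsEquilibriumOfLength (q + 2 * z) (2 * (q + z) + l)
      (surround q z x) := by
  obtain ⟨hfeasible, π, hπ, hπl⟩ := hx
  exact ⟨isFeasible_surround hfeasible hq hz, exists_isPotential_surround hπ hπl hle heq⟩

theorem isEquilibriumOfLength_surround_zero (hx : (nestedBraess j).IsEquilibriumOfLength q l x)
    (hq : 0 ≤ q) (hle : q + l ≤ 10 ^ j) :
    (nestedBraess (j + 1)).IsEquilibriumOfLength q (2 * q + l) (surround q 0 x) := by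
  simpa using isEquilibriumOfLength_surround hx hq le_rfl (by simpa using hle) (by simp)

theorem isEquilibriumOfLength_surround_sub (hx : (nestedBraess j).IsEquilibriumOfLength q l x)
    (hq : 0 ≤ q) (hle : q + l ≤ 10 ^ j) :
    (nestedBraess (j + 1)).IsEquilibriumOfLength (2 * 10 ^ j - q - 2 * l) (2 * 10 ^ j - l)
      (surround q (10 ^ j - q - l) x) := by
  convert isEquilibriumOfLength_surround hx hq (z := 10 ^ j - q - l) (by linarith)
    (by linarith) (fun _ => by ring) using 1 <;> ring

end Surround

section Existence

variable {q l : ℝ}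

theorem offset_nonneg (e : Vertex j × Vertex j) : 0 ≤ offset j e := by
  unfold offset
  split_ifs <;> positivity

theorem isEquilibriumOfLength_zero (j : ℕ) (hl : l ≤ 0) :
    (nestedBraess j).IsEquilibriumOfLength 0 l 0 := by
  refine ⟨isFeasible_zero, Pi.single (Fin.last _) l, ⟨fun e he => ?_, ?_⟩, by simp⟩
  · have hlt := (increasing_nestedBraess j e he).trans_le (Fin.le_last e.2)
    have hle : Pi.single (M := fun _ => ℝ) (Fin.last _) l e.2 ≤ 0 := by
      rw [Pi.single_apply]
      split_ifs <;> simp [hl]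
    simpa [cost_nestedBraess, hlt.ne] using hle.trans (offset_nonneg e)
  · simp

theorem isEquilibriumOfLength_single (hq : 0 ≤ q) :
    (nestedBraess 0).IsEquilibriumOfLength q 0 (Pi.single (0, 1) q) := by
  have hcost : (nestedBraess 0).cost (0, 1) q = 0 := by
    simp [cost_nestedBraess, slope, offset, mem_E₁, mem_E₂, mem_E₃]
  refine ⟨isFeasible_iff.2 ⟨fun e he => ?_, fun e => ?_,
    netInflow_single 0 1 q⟩, 0, ⟨?_, ?_⟩, by simp⟩
  · rw [edges_zero, Finset.mem_singleton] at he
    exact Pi.single_eq_of_ne (M := fun _ => ℝ) he q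
  · exact (Pi.single_nonneg.2 hq : (0 : Vertex 0 × Vertex 0 → ℝ) ≤ _) e
  · simp [edges_zero, hcost]
  · simp [edges_zero, hcost]

theorem isEquilibriumOfLength_of_two_mul_pow_le (hq : 2 * 10 ^ j ≤ q) :
    (nestedBraess (j + 1)).IsEquilibriumOfLength q (10 ^ j + q / 2) (surround 0 (q / 2) 0) := by
  have hpos : (0 : ℝ) < 10 ^ j := by positivity
  convert isEquilibriumOfLength_surround (z := q / 2)
    (isEquilibriumOfLength_zero j (l := 10 ^ j - q / 2) (by linarith)) le_rfl (by linarith)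
    (by linarith) (fun _ => by ring) using 1 <;> ring

-- Mere existence for every `q` does not pass from `j` to `j + 1`, since `surround` mixes rates and
-- lengths; meeting every line of negative slope in the `(q, l)`-plane does.
theorem exists_isEquilibriumOfLength_mul_add_mul_eq (j : ℕ) {a b s : ℝ} (ha : 0 < a) (hb : 0 ≤ b)
    (hs : b = 0 → 0 ≤ s) :
    ∃ q l x, 0 ≤ q ∧ (nestedBraess j).IsEquilibriumOfLength q l x ∧ a * q + b * l = s := by
  induction j generalizing a b s with
  | zero =>
    rcases le_or_gt 0 s with hs0 | hs0
    · exact ⟨s / a, 0, _, by positivity, isEquilibriumOfLength_single (by positivity),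
        by rw [mul_zero, add_zero, mul_div_cancel₀ s ha.ne']⟩
    · have hb' : 0 < b := hb.lt_of_ne' fun h => hs0.not_ge (hs h)
      exact ⟨0, s / b, 0, le_rfl,
        isEquilibriumOfLength_zero 0 (div_nonpos_of_nonpos_of_nonneg hs0.le hb),
        by rw [mul_zero, zero_add, mul_div_cancel₀ s hb'.ne']⟩
  | succ j ih =>
    obtain ⟨q₁, l₁, x₁, hq₁, hx₁, hs₁⟩ :=
      ih (a := a + 2 * b) (b := b) (s := s) (by positivity) hb hs
    by_cases h₁ : q₁ + l₁ ≤ 10 ^ j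
    · exact ⟨q₁, _, _, hq₁, isEquilibriumOfLength_surround_zero hx₁ hq₁ h₁, by linarith⟩
    obtain ⟨q₂, l₂, x₂, hq₂, hx₂, hs₂⟩ := ih (a := a) (b := 2 * a + b)
      (s := 2 * 10 ^ j * (a + b) - s) ha (by positivity) (fun h => by linarith)
    have h₂ : q₂ + l₂ ≤ 10 ^ j := by
      by_contra h₂
      push Not at h₁ h₂
      obtain ⟨hA, hB⟩ : 2 * 10 ^ j < q₁ + q₂ + 2 * l₂ ∧ 2 * 10 ^ j ≤ 2 * q₁ + l₁ + l₂ := by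
        rcases mul_nonneg_iff.1 (hx₁.sub_mul_sub_nonneg (fun e _ => monotoneOn_cost e) hx₂) with
          ⟨hq, hl⟩ | ⟨hq, hl⟩ <;> constructor <;> linarith [hq, hl]
      linarith [mul_lt_mul_of_pos_left hA ha, mul_le_mul_of_nonneg_left hB hb]
    exact ⟨_, _, _, by linarith, isEquilibriumOfLength_surround_sub hx₂ hq₂ h₂, by linarith⟩

theorem existsUnique_isWardropEquilibrium (j : ℕ) (hq : 0 ≤ q) :
    ∃! x, (nestedBraess j).IsWardropEquilibrium q x := by
  obtain ⟨q, l, x, -, hx, rfl⟩ :=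
    exists_isEquilibriumOfLength_mul_add_mul_eq j one_pos le_rfl (fun _ => hq)
  rw [one_mul, zero_mul, add_zero] at hq ⊢
  exact ⟨x, hx.isWardropEquilibrium (increasing_nestedBraess j), fun y hy =>
    isWardropEquilibrium_unique hq hy (hx.isWardropEquilibrium (increasing_nestedBraess j))⟩

end Existence

section Supports

/-- The support of `surround y z x`, where `y + z ≠ 0`, in terms of the support `S` of `x` and of
whether `p : z ≠ 0` holds. -/
def surroundSupport (p : Prop) (S : Set (Vertex j × Vertex j)) :
    Set (Vertex (j + 1) × Vertex (j + 1)) :=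
  {e | (∃ e' ∈ S, shiftEdge e' = e) ∨ e = (0, shift 0) ∨ e = (shift (Fin.last _), Fin.last _) ∨
    p ∧ (e = (0, shift (Fin.last _)) ∨ e = (shift 0, Fin.last _))}

theorem surroundSupport_injective :
    Function.Injective fun P : Prop × Set (Vertex j × Vertex j) => surroundSupport P.1 P.2 := by
  rintro ⟨p, S⟩ ⟨p', S'⟩ h
  refine Prod.ext (propext ?_) (Set.ext fun e => ?_)
  · simpa [surroundSupport] using Set.ext_iff.1 h (0, shift (Fin.last _))
  · simpa [surroundSupport] using Set.ext_iff.1 h (shift e.1, shift e.2)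

theorem support_surround {y z : ℝ} {x : Vertex j × Vertex j → ℝ} (hyz : y + z ≠ 0) :
    Function.support (surround y z x) = surroundSupport (z ≠ 0) (Function.support x) := by
  ext e
  by_cases hinner : e ∈ Set.range shiftEdge
  · obtain ⟨⟨u, v⟩, rfl⟩ := hinner
    rw [Function.mem_support, surround_shiftEdge]
    simp [surroundSupport]
  by_cases houter : e ∈ outerEdges j
  · clear hinner
    simp only [outerEdges, Finset.mem_insert, Finset.mem_singleton] at houter
    rcases houter with rfl | rfl | rfl | rfl <;> simp [surroundSupport, hyz]
  · have hnotMem : ∀ e', shiftEdge e' ≠ e := fun e' h => hinner ⟨e', h⟩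
    simp only [outerEdges, Finset.mem_insert, Finset.mem_singleton, not_or] at houter
    simp [-shiftEdge_apply, surroundSupport, surround, houter, hnotMem]

/-- The positive demand rates below `3 * 10 ^ (j - 1)` whose equilibrium has the support `S`. -/
def supportRates (j : ℕ) (S : Set (Vertex j × Vertex j)) : Set ℝ :=
  {q | 0 < q ∧ q < 3 * 10 ^ j / 10 ∧
    ∃ l x, (nestedBraess j).IsEquilibriumOfLength q l x ∧ Function.support x = S}

/-- The supports of equilibria that occur for infinitely many positive demand rates below
`3 * 10 ^ (j - 1)`. Unlike the plain supports of equilibria, each of them accounts for a part of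
every piecewise linear representation of the equilibrium function. -/
def recurrentSupports (j : ℕ) : Set (Set (Vertex j × Vertex j)) :=
  {S | (supportRates j S).Infinite}

variable {q l : ℝ} {x : Vertex j × Vertex j → ℝ} {S : Set (Vertex j × Vertex j)}

theorem length_nonneg (hx : (nestedBraess j).IsEquilibriumOfLength q l x) (hq : 0 < q) : 0 ≤ l :=
  (isEquilibriumOfLength_zero j le_rfl).length_le (fun e _ => monotoneOn_cost e) hx hq

theorem add_length_lt (hx : (nestedBraess j).IsEquilibriumOfLength q l x) (hq : 0 < q)
    (hlt : q < 3 * 10 ^ j / 10) : q + l < 10 ^ j := by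
  cases j with
  | zero =>
    have := hx.length_le (fun e _ => monotoneOn_cost e)
      (isEquilibriumOfLength_single (q := q + 1) (by linarith)) (by linarith)
    norm_num at hlt ⊢
    linarith
  | succ j =>
    rw [pow_succ] at hlt ⊢
    have hpos : (0 : ℝ) < 10 ^ j := by positivity
    have := hx.length_le (fun e _ => monotoneOn_cost e)
      (isEquilibriumOfLength_of_two_mul_pow_le (q := 3 * 10 ^ j) (by linarith)) (by linarith)
    linarith

theorem empty_notMem_recurrentSupports (j : ℕ) : ∅ ∉ recurrentSupports j := by
  intro h
  obtain ⟨q, hq, -, l, x, hx, hS⟩ := h.nonempty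
  rw [Function.support_eq_empty_iff] at hS
  have := congrFun hx.1.netInflow_eq 0
  simp [hS, hq.ne'] at this

theorem surroundSupport_false_mem (hS : S ∈ recurrentSupports j) :
    surroundSupport False S ∈ recurrentSupports (j + 1) := by
  refine hS.mono ?_
  rintro q ⟨hq, hlt, l, x, hx, rfl⟩
  have hpos : (0 : ℝ) < 10 ^ j := by positivity
  refine ⟨hq, by rw [pow_succ]; linarith [hpos], _, _,
    isEquilibriumOfLength_surround_zero hx hq.le (add_length_lt hx hq hlt).le, ?_⟩
  simp [support_surround, hq.ne']

theorem surroundSupport_true_mem (hS : S ∈ recurrentSupports j) :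
    surroundSupport True S ∈ recurrentSupports (j + 1) := by
  choose! l x hx hxS using fun q (hq : q ∈ supportRates j S) => hq.2.2
  have hanti : StrictAntiOn (fun q => 2 * 10 ^ j - q - 2 * l q) (supportRates j S) := by
    intro q hq r hr hqr
    have := (hx q hq).length_le (fun e _ => monotoneOn_cost e) (hx r hr) hqr
    simp only
    linarith
  refine Set.infinite_of_injOn_mapsTo hanti.injOn (fun q hq => ?_) hS
  have hlt := add_length_lt (hx q hq) hq.1 hq.2.1
  have hl := length_nonneg (hx q hq) hq.1
  refine ⟨?_, ?_, _, _, isEquilibriumOfLength_surround_sub (hx q hq) hq.1.le hlt.le, ?_⟩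
  · linarith [hq.1, hq.2.1]
  · rw [pow_succ]
    linarith [hq.1]
  · have hz : 0 < 10 ^ j - q - l q := by linarith
    rw [support_surround (add_pos hq.1 hz).ne', hxS q hq, eq_true hz.ne']

theorem surroundSupport_true_empty_mem (j : ℕ) :
    surroundSupport True ∅ ∈ recurrentSupports (j + 1) := by
  have hpos : (0 : ℝ) < 10 ^ j := by positivity
  refine (Set.Ioo_infinite (show 2 * 10 ^ j < 3 * (10 : ℝ) ^ j by linarith)).mono fun q hq => ?_
  refine ⟨by linarith [hq.1], by rw [pow_succ]; linarith [hq.2], _, _,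
    isEquilibriumOfLength_of_two_mul_pow_le hq.1.le, ?_⟩
  have hq0 : q / 2 ≠ 0 := by linarith [hq.1]
  simp [support_surround, hq0]

theorem two_pow_le_ncard_recurrentSupports_add_one (j : ℕ) :
    2 ^ (j + 1) ≤ (recurrentSupports j).ncard + 1 := by
  induction j with
  | zero =>
    have : (recurrentSupports 0).Nonempty := by
      refine ⟨{(0, 1)}, (Set.Ioo_infinite (show (0 : ℝ) < 3 * 10 ^ 0 / 10 by norm_num)).mono ?_⟩
      rintro q ⟨hq, hlt⟩
      exact ⟨hq, hlt, 0, _, isEquilibriumOfLength_single hq.le, Pi.support_single_of_ne hq.ne'⟩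
    have := this.ncard_pos
    omega
  | succ j ih =>
    have hsub : (fun P : Prop × Set _ => surroundSupport P.1 P.2) ''
        insert (True, ∅) (Set.univ ×ˢ recurrentSupports j) ⊆ recurrentSupports (j + 1) := by
      rintro _ ⟨⟨p, S⟩, hP | ⟨-, hS⟩, rfl⟩
      · rw [hP]
        exact surroundSupport_true_empty_mem j
      · by_cases hp : p
        · simpa only [hp] using surroundSupport_true_mem hS
        · simpa only [hp] using surroundSupport_false_mem hS
    have hcard := Set.ncard_le_ncard hsub
    rw [Set.ncard_image_of_injective _ surroundSupport_injective, Set.ncard_insert_of_notMem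
      (fun h => empty_notMem_recurrentSupports j h.2), Set.ncard_prod, Set.ncard_univ,
      Nat.card_eq_fintype_card, Fintype.card_prop] at hcard
    rw [pow_succ]
    omega

end Supports

section Counting

theorem exists_injective_rates_flowSupport_ne (hj : 1 ≤ j) :
    ∃ q : Fin (2 ^ (j + 1)) → ℝ, Function.Injective q ∧
      (∀ i, q i ∈ Set.Ico (0 : ℝ) (3 * 10 ^ (j - 1))) ∧
      ∀ i k, i ≠ k → ∀ x y, (nestedBraess j).IsWardropEquilibrium (q i) x →
        (nestedBraess j).IsWardropEquilibrium (q k) y →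
        (nestedBraess j).flowSupport x ≠ (nestedBraess j).flowSupport y := by
  have hbound : (3 : ℝ) * 10 ^ (j - 1) = 3 * 10 ^ j / 10 := by
    obtain ⟨k, rfl⟩ := Nat.exists_eq_add_of_le' hj
    rw [Nat.add_sub_cancel, pow_succ]
    ring
  have := Fintype.ofFinite ↥(insert ∅ (recurrentSupports j))
  have hcard : Fintype.card (Fin (2 ^ (j + 1))) ≤
      Fintype.card ↥(insert ∅ (recurrentSupports j)) := by
    rw [Fintype.card_fin, ← Nat.card_eq_fintype_card, Nat.card_coe_set_eq,
      Set.ncard_insert_of_notMem (empty_notMem_recurrentSupports j)]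
    exact two_pow_le_ncard_recurrentSupports_add_one j
  obtain ⟨S⟩ := Function.Embedding.nonempty_of_card_le hcard
  have hrate (i) : ∃ q ∈ Set.Ico (0 : ℝ) (3 * 10 ^ (j - 1)), ∃ l x,
      (nestedBraess j).IsEquilibriumOfLength q l x ∧ Function.support x = S i := by
    rcases (S i).2 with hempty | hrecurrent
    · exact ⟨0, ⟨le_rfl, by positivity⟩, 0, 0, isEquilibriumOfLength_zero j le_rfl,
        by rw [hempty, Function.support_zero]⟩
    · obtain ⟨q, hq, hlt, hx⟩ := hrecurrent.nonempty
      exact ⟨q, ⟨hq.le, hbound ▸ hlt⟩, hx⟩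
  choose q hq l x hx hxS using hrate
  have hequilibrium (i) := (hx i).isWardropEquilibrium (increasing_nestedBraess j)
  have hne : ∀ i k, i ≠ k → ∀ y z, (nestedBraess j).IsWardropEquilibrium (q i) y →
      (nestedBraess j).IsWardropEquilibrium (q k) z →
      (nestedBraess j).flowSupport y ≠ (nestedBraess j).flowSupport z := by
    intro i k hik y z hy hz heq
    rw [isWardropEquilibrium_unique (hq i).1 hy (hequilibrium i),
      isWardropEquilibrium_unique (hq k).1 hz (hequilibrium k), (hx i).1.flowSupport_eq,
      (hx k).1.flowSupport_eq, hxS, hxS] at heq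
    exact hik (S.injective (Subtype.ext heq))
  refine ⟨q, fun i k hqik => ?_, hq, hne⟩
  by_contra hik
  exact hne i k hik (x i) (x i) (hequilibrium i) (hqik ▸ hequilibrium i) rfl

variable {f : ℝ → Vertex j × Vertex j → ℝ} {B : Finset ℝ}

theorem exists_isBreakpointSet (hf : (nestedBraess j).IsEquilibriumFunction f) :
    ∃ B, IsBreakpointSet f B :=
  DirectedNetwork.exists_isBreakpointSet (hasAffineCosts_nestedBraess j)
    (fun _ _ _ hq => isWardropEquilibrium_unique hq) hf

theorem two_pow_succ_le_card_add_one (hf : (nestedBraess j).IsEquilibriumFunction f)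
    (hB : IsBreakpointSet f B) : 2 ^ (j + 1) ≤ B.card + 1 := by
  have hsub : recurrentSupports j ⊆
      {S | {q | 0 ≤ q ∧ Function.support (f q) = S}.Infinite} := by
    refine fun S hS => hS.mono fun q hq => ?_
    obtain ⟨hpos, -, l, x, hx, hxS⟩ := hq
    refine ⟨hpos.le, ?_⟩
    rw [isWardropEquilibrium_unique hpos.le (hf q hpos.le)
      (hx.isWardropEquilibrium (increasing_nestedBraess j)), hxS]
  have hncard := (Set.ncard_le_ncard hsub).trans
    (hB.ncard_infinite_supports_le fun q hq => (hf q hq).feasible.nonneg')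
  exact (two_pow_le_ncard_recurrentSupports_add_one j).trans (Nat.add_le_add_right hncard 1)

theorem two_pow_le_card (hf : (nestedBraess j).IsEquilibriumFunction f)
    (hB : IsBreakpointSet f B) : 2 ^ j ≤ B.card := by
  have h := two_pow_succ_le_card_add_one hf hB
  have := Nat.one_le_two_pow (n := j)
  rw [pow_succ] at h
  omega

theorem pow_card_vertex_add_card_edges_le (hj : 1 ≤ j) :
    (21 / 20 : ℝ) ^ (Fintype.card (Vertex j) + (nestedBraess j).edges.card) ≤ 2 ^ j := by
  rw [Fintype.card_fin, card_edges]
  calc (21 / 20 : ℝ) ^ (2 * j + 2 + (4 * j + 1))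
      ≤ (21 / 20) ^ (9 * j) := pow_le_pow_right₀ (by norm_num) (by omega)
    _ = ((21 / 20) ^ 9) ^ j := pow_mul _ _ _
    _ ≤ 2 ^ j := pow_le_pow_left₀ (by norm_num) (by norm_num) j

end Counting

end NestedBraess

theorem mainTheorem11 :
    (∀ j : ℕ, 1 ≤ j →
      Fintype.card (NestedBraess.Vertex j) = 2 * j + 2 ∧
      (nestedBraess j).edges.card = 4 * j + 1 ∧
      -- the equilibrium exists and is unique for every demand rate
      (∀ q : ℝ, 0 ≤ q → ∃! x, (nestedBraess j).IsWardropEquilibrium q x) ∧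
      -- demand rates with pairwise different support sets
      (∃ q : Fin (2 ^ (j + 1)) → ℝ, Function.Injective q ∧
        (∀ i, q i ∈ Set.Ico (0 : ℝ) (3 * 10 ^ (j - 1))) ∧
        ∀ i k, i ≠ k → ∀ x y,
          (nestedBraess j).IsWardropEquilibrium (q i) x →
          (nestedBraess j).IsWardropEquilibrium (q k) y →
          (nestedBraess j).flowSupport x ≠ (nestedBraess j).flowSupport y) ∧
      -- the equilibrium function is piecewise linear with at least `2 ^ (j + 1) - 1` parts
      (∀ f, (nestedBraess j).IsEquilibriumFunction f →
        (∃ B, IsBreakpointSet f B) ∧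
        ∀ B, IsBreakpointSet f B → 2 ^ (j + 1) ≤ B.card + 1)) ∧
    -- the number of parts is exponential in the number of vertices and edges
    (∃ c : ℝ, 1 < c ∧ ∀ j : ℕ, 1 ≤ j → ∀ f, (nestedBraess j).IsEquilibriumFunction f →
      ∀ B, IsBreakpointSet f B →
        c ^ (Fintype.card (NestedBraess.Vertex j) + (nestedBraess j).edges.card) ≤ (B.card : ℝ)) := by
  refine ⟨fun j hj => ⟨Fintype.card_fin _, NestedBraess.card_edges j,
    fun q hq => NestedBraess.existsUnique_isWardropEquilibrium j hq,
    NestedBraess.exists_injective_rates_flowSupport_ne hj,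
    fun f hf => ⟨NestedBraess.exists_isBreakpointSet hf,
      fun B hB => NestedBraess.two_pow_succ_le_card_add_one hf hB⟩⟩,
    21 / 20, by norm_num, fun j hj f hf B hB => ?_⟩
  exact (NestedBraess.pow_card_vertex_add_card_edges_le hj).trans
    (by exact_mod_cast NestedBraess.two_pow_le_card hf hB)
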